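/- Let $T=[t_0,t_f]$ with $t_0<t_f$, let $1\le p<\infty$, and let $Y\subset\mathbb R^n$ be compact. Let $\gamma\mathbb R^m$ be the compactification of $\mathbb R^m$ by the sphere at infinity, i.e. the one for which the continuous functions on $\gamma\mathbb R^m$ restrict exactly to the ring $\mathcal R$ of bounded continuous functions of the form $v(u)=c+v_0(u)+v_1(u/|u|)\frac{|u|^p}{1+|u|^p}$, with $c\in\mathbb R$, $v_0$ continuous and vanishing at infinity, and $v_1$ continuous on the unit sphere. **Dynamics.** Let $f(t,y,u)=c(t,y,u)+d(t,u)\in\mathbb R^n$ for $t\in T$, $y\in Y$, $u\in\mathbb R^m$, where $c$ is Carathéodory (measurable in $t$ for all $(y,u)$, continuous in $(y,u)$ for a.e. $t$), where $d_0(t,u):=d(t,u)/(1+|u|^p)$ belongs to $C(T;\mathcal R^n)$, and where, for some $\varepsilon>0$, $\beta\in\mathbb R$, $\alpha_1\in L^1(T)$, $\alpha_{1+\varepsilon}\in L^{1+\varepsilon}(T)$ and all $t\in T$, $y,y_1,y_2\in Y$, $u\in\mathbb R^m$, $$|c(t,y,u)|\le \alpha_{1+\varepsilon}(t)+\beta\bigl(|y|^{1/\varepsilon}+|u|^{p/(1+\varepsilon)}\bigr),\qquad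 |c(t,y,u)|\le(\alpha_1(t)+\beta|u|^p)(1+|y|),$$ $$|c(t,y_1,u)-c(t,y_2,u)|\le\bigl(\alpha_1(t)+\beta|y_1|^{1/\varepsilon}+\beta|y_2|^{1/\varepsilon}+\beta|u|^{p/(1+\varepsilon)}\bigr)|y_1-y_2| .$$ The functions $u\mapsto \frac{1}{1+|u|^p}$ and $u\mapsto\frac{f(t,y,u)}{1+|u|^p}$ are extended by continuity to $\gamma\mathbb R^m$ and denoted by the same symbols. **Relaxed controls.** Let $(\sigma,\nu)$ be a DiPerna–Majda measure: $\sigma$ is a finite positive Borel measure on $T$, $\nu(\cdot|t)$ is a measurable family of probability measures on $\gamma\mathbb R^m$, and there is a sequence $u_k\in L^p(T;\mathbb R^m)$ such that for every $h_0\in C(T\times\gamma\mathbb R^m)$ $$\lim_{k\to\infty}\int_T h_0(t,u_k(t))(1+|u_k(t)|^p)\,dt=\int_T\int_{\gamma\mathbb R^m}h_0(t,u)\,\nu(du|t)\,\sigma(dt).$$ Let $J=\{s:\sigma(\{s\})\neq0\}$ be the set of atoms of $\sigma$, and let $\sigma_C$ be the restriction of $\sigma$ to $T\setminus J$. **Relaxed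 arcs.** Let $y$ be a function of bounded variation with values in $Y$ on $T$, extended by constants outside $T$ (so that jumps at $t_0$ and $t_f$ are allowed), with prescribed boundary values $y(t_0^-)=y_0$ and $y(t_f^+)=y_f$. Suppose that $y$ solves the relaxed differential equation with space-time reparametrization $(y_s)_{s\in J}$: for all $\tau\in T$, $$y(\tau^+)=y(t_0^-)+\int_{[t_0,\tau]}\int_{\gamma\mathbb R^m}\frac{f(t,y(t),u)}{1+|u|^p}\,\nu(du|t)\,\sigma_C(dt)+\sum_{s\in J\cap[t_0,\tau]}\bigl(y(s^+)-y(s^-)\bigr),$$ and for each $s\in J$ the function $y_s:[0,\sigma(\{s\})]\to Y$ satisfies $$\dot y_s(r)=\int_{\gamma\mathbb R^m}\frac{f(s,y_s(r),u)}{1+|u|^p}\,\nu(du|s)\ \ (0\le r\le\sigma(\{s\})),\qquad y_s(0)=y(s^-),\quad y_s(\sigma(\{s\}))=y(s^+).$$ Such a triple $(\sigma,\nu,y)$ is an admissible relaxed arc. Its occupation measure $\mu$ on $T\times Y\times\gamma\mathbb R^m$ is $$d\mu(t,y,u)=\xi(dy|t)\,\nu(du|t)\,\sigma(dt),$$ where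 $\xi(\cdot|s)=\delta_{y(s)}$ if $s\notin J$, and $\xi(B|s)=\frac1{\sigma(\{s\})}\int_0^{\sigma(\{s\})}I_B(y_s(r))\,dr$ if $s\in J$. **Claim.** For every test function $v\in C^1(T\times Y)$ (i.e. $v$ is $C^1$ on an open neighbourhood of $T\times Y$), the function $\frac{\partial v}{\partial t}\frac1{1+|u|^p}+\frac{\partial v}{\partial y}\cdot\frac{f(t,y,u)}{1+|u|^p}$ is $\mu$-integrable and $$\Bigl\langle\frac{\partial v}{\partial t}\,\frac1{1+|u|^p}+\frac{\partial v}{\partial y}\cdot\frac{f(t,y,u)}{1+|u|^p},\ \mu\Bigr\rangle=v(t_f,y(t_f^+))-v(t_0,y(t_0^-)).$$ -/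

import Mathlib

open Set Filter Topology MeasureTheory ProbabilityTheory
open scoped BoundedContinuousFunction

noncomputable section

namespace DiPernaMajda

/-- Euclidean space of dimension `k`. -/
abbrev Euc (k : ℕ) : Type := EuclideanSpace ℝ (Fin k)

/-! ### The ring of test integrands and the corresponding compactification -/

/-- The subring `𝓡` of bounded continuous functions of the form
`v(u) = c + v₀(u) + v₁(u/|u|) |u|^p / (1 + |u|^p)` with `v₀` continuous and vanishing at infinity
and `v₁` continuous on the unit sphere. -/
def sphereRing (p : ℝ) (m : ℕ) : Set (Euc m →ᵇ ℝ) :=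
  {v | ∃ (c : ℝ) (v₀ : Euc m →ᵇ ℝ) (v₁ : Euc m → ℝ),
    Tendsto v₀ (cocompact (Euc m)) (𝓝 0) ∧ ContinuousOn v₁ (Metric.sphere 0 1) ∧
    ∀ u, v u = c + v₀ u + v₁ (‖u‖⁻¹ • u) * (‖u‖ ^ p / (1 + ‖u‖ ^ p))}

/-- The compactification `γℝᵐ` of `ℝᵐ` by a sphere at infinity, realised as the closed unit ball.
By `mem_sphereRing_iff` below, `𝓡` consists exactly of the restrictions to `ℝᵐ` of the continuous
functions on it. -/
abbrev Gam (m : ℕ) : Type := Metric.closedBall (0 : Euc m) 1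

/-- The embedding `u ↦ u / (1 + |u|)` of `ℝᵐ` in `γℝᵐ`. -/
def toGam {m : ℕ} (u : Euc m) : Gam m :=
  ⟨(1 + ‖u‖)⁻¹ • u, by
    have h : 0 < 1 + ‖u‖ := by positivity
    rw [mem_closedBall_zero_iff, norm_smul, norm_inv, Real.norm_of_nonneg h.le,
      inv_mul_le_iff₀ h]
    linarith⟩

/-- Extension by continuity to `γℝᵐ` of a function on `ℝᵐ`. -/
def extGam {m : ℕ} {X : Type*} [TopologicalSpace X] [Nonempty X] (g : Euc m → X) (z : Gam m) : X :=
  limUnder (comap toGam (𝓝 z)) g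

theorem norm_toGam {m : ℕ} (u : Euc m) : ‖(toGam u : Euc m)‖ = ‖u‖ / (1 + ‖u‖) := by
  have h : 0 < 1 + ‖u‖ := by positivity
  simp only [toGam]
  rw [norm_smul, norm_inv, Real.norm_of_nonneg h.le]
  field_simp

theorem norm_toGam_lt {m : ℕ} (u : Euc m) : ‖(toGam u : Euc m)‖ < 1 := by
  have h : 0 < 1 + ‖u‖ := by positivity
  rw [norm_toGam, div_lt_one h]
  linarith

theorem inv_toGam {m : ℕ} (u : Euc m) :
    (1 - ‖(toGam u : Euc m)‖)⁻¹ • (toGam u : Euc m) = u := by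
  have h : 0 < 1 + ‖u‖ := by positivity
  rw [norm_toGam]
  simp only [toGam, smul_smul]
  have : (1 - ‖u‖ / (1 + ‖u‖))⁻¹ * (1 + ‖u‖)⁻¹ = 1 := by field_simp; ring
  rw [this, one_smul]

theorem toGam_inv {m : ℕ} (z : Gam m) (hz : ‖(z : Euc m)‖ < 1) :
    toGam ((1 - ‖(z : Euc m)‖)⁻¹ • (z : Euc m)) = z := by
  have h : 0 < 1 - ‖(z : Euc m)‖ := by linarith
  apply Subtype.ext
  simp only [toGam]
  rw [norm_smul, norm_inv, Real.norm_of_nonneg h.le, smul_smul]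
  have : (1 + (1 - ‖(z : Euc m)‖)⁻¹ * ‖(z : Euc m)‖)⁻¹ * (1 - ‖(z : Euc m)‖)⁻¹ = 1 := by
    field_simp; ring
  rw [this, one_smul]

theorem continuous_toGam {m : ℕ} : Continuous (toGam (m := m)) := by
  refine Continuous.subtype_mk ?_ _
  have h : Continuous fun u : Euc m => 1 + ‖u‖ := by fun_prop
  exact (h.inv₀ fun u => by positivity).smul continuous_id

theorem isEmbedding_toGam {m : ℕ} : IsEmbedding (toGam (m := m)) := by
  refine ⟨⟨le_antisymm continuous_toGam.le_induced ?_⟩, fun a b hab => ?_⟩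
  · refine le_of_nhds_le_nhds fun u => ?_
    rw [nhds_induced]
    have hc : ContinuousAt (fun z : Gam m => (1 - ‖(z : Euc m)‖)⁻¹ • (z : Euc m)) (toGam u) := by
      have h : ContinuousAt (fun z : Gam m => 1 - ‖(z : Euc m)‖) (toGam u) := by fun_prop
      exact (h.inv₀ (ne_of_gt (by linarith [norm_toGam_lt u]))).smul
        continuous_subtype_val.continuousAt
    have h2 := hc.tendsto.comp (tendsto_comap (f := toGam) (x := 𝓝 (toGam u)))
    rw [inv_toGam] at h2
    refine h2.congr (f₂ := id) fun w => inv_toGam w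
  · rw [← inv_toGam a, ← inv_toGam b, hab]

theorem denseRange_toGam {m : ℕ} : DenseRange (toGam (m := m)) := by
  intro z
  have hz : ‖(z : Euc m)‖ ≤ 1 := mem_closedBall_zero_iff.mp z.2
  have hlt : ∀ k : ℕ, ‖((1 - 1 / ((k : ℝ) + 1)) • (z : Euc m))‖ < 1 := fun k => by
    have h1 : (0 : ℝ) < 1 / ((k : ℝ) + 1) := by positivity
    have h2 : 1 / ((k : ℝ) + 1) ≤ 1 := by
      rw [div_le_one (by positivity)]; linarith [(Nat.cast_nonneg k : (0 : ℝ) ≤ k)]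
    rw [norm_smul, Real.norm_of_nonneg (by linarith)]
    nlinarith [norm_nonneg (z : Euc m)]
  refine mem_closure_of_tendsto (b := atTop)
    (f := fun k : ℕ => (⟨(1 - 1 / ((k : ℝ) + 1)) • (z : Euc m),
      mem_closedBall_zero_iff.mpr (hlt k).le⟩ : Gam m)) ?_ ?_
  · rw [tendsto_subtype_rng]
    have : Tendsto (fun k : ℕ => (1 - 1 / ((k : ℝ) + 1)) • (z : Euc m)) atTop
        (𝓝 ((1 - (0 : ℝ)) • (z : Euc m))) :=
      (tendsto_const_nhds.sub tendsto_one_div_add_atTop_nhds_zero_nat).smul_const _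
    simpa using this
  · exact Eventually.of_forall fun k => ⟨_, toGam_inv _ (hlt k)⟩

/-- The ring `𝓡` is the ring of restrictions of continuous functions on `γℝᵐ`. -/
theorem mem_sphereRing_iff {p : ℝ} (hp : 1 ≤ p) {m : ℕ} (v : Euc m →ᵇ ℝ) :
    v ∈ sphereRing p m ↔ ∃ V : C(Gam m, ℝ), ∀ u, V (toGam u) = v u := by
  have hp0 : 0 < p := by linarith
  constructor
  · rintro ⟨c, v₀, v₁, hv₀, hv₁, hv⟩
    let inv : Gam m → Euc m := fun z => (1 - ‖(z : Euc m)‖)⁻¹ • (z : Euc m)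
    let ρ : ℝ → ℝ := fun r => r ^ p / ((1 - r) ^ p + r ^ p)
    let V₀ : Gam m → ℝ := fun z => if ‖(z : Euc m)‖ < 1 then v₀ (inv z) else 0
    let V₁ : Gam m → ℝ := fun z =>
      v₁ (‖(z : Euc m)‖⁻¹ • (z : Euc m)) * ρ ‖(z : Euc m)‖
    have hnle : ∀ z : Gam m, ‖(z : Euc m)‖ ≤ 1 := fun z => mem_closedBall_zero_iff.mp z.2
    have hρ : ContinuousOn ρ (Icc 0 1) := by
      intro r hr
      refine ContinuousAt.continuousWithinAt ?_
      refine ContinuousAt.div ?_ ?_ ?_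
      · exact continuousAt_id.rpow_const (Or.inr hp0.le)
      · exact ((continuousAt_const.sub continuousAt_id).rpow_const (Or.inr hp0.le)).add
          (continuousAt_id.rpow_const (Or.inr hp0.le))
      · rcases hr.1.eq_or_lt with h | h
        · subst h; simp [Real.zero_rpow hp0.ne']
        · have := Real.rpow_pos_of_pos h p
          have := Real.rpow_nonneg (sub_nonneg.mpr hr.2) p
          positivity
    have hV₀ : Continuous V₀ := by
      rw [continuous_iff_continuousAt]
      intro z
      rcases (hnle z).lt_or_eq with hz | hz
      · have hev : ∀ᶠ w : Gam m in 𝓝 z, ‖(w : Euc m)‖ < 1 :=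
          (continuous_subtype_val.norm.continuousAt (x := z)).eventually (gt_mem_nhds hz)
        refine ContinuousAt.congr (f := fun w => v₀ (inv w)) ?_
          (hev.mono fun w hw => (if_pos hw).symm)
        refine v₀.continuous.continuousAt.comp ?_
        have h : ContinuousAt (fun z : Gam m => 1 - ‖(z : Euc m)‖) z := by fun_prop
        exact (h.inv₀ (ne_of_gt (by linarith))).smul continuous_subtype_val.continuousAt
      · have hz0 : V₀ z = 0 := if_neg (by rw [hz]; exact lt_irrefl _)
        rw [ContinuousAt, hz0, Metric.tendsto_nhds]
        intro ε hε
        have h1 := Metric.tendsto_nhds.mp hv₀ ε hε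
        rw [← Metric.cobounded_eq_cocompact, ← comap_norm_atTop] at h1
        obtain ⟨s, hs, hsub⟩ := mem_comap.mp h1
        obtain ⟨M, hM⟩ := mem_atTop_sets.mp hs
        have hlim : Tendsto (fun w : Gam m => ‖(w : Euc m)‖ + |M| * ‖(w : Euc m)‖) (𝓝 z)
            (𝓝 (1 + |M| * 1)) := by
          have : Tendsto (fun w : Gam m => ‖(w : Euc m)‖) (𝓝 z) (𝓝 1) := by
            have h := (continuous_subtype_val.norm.continuousAt (x := z)).tendsto
            simp only [hz] at h
            exact h
          exact this.add (this.const_mul _)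
        filter_upwards [hlim.eventually (lt_mem_nhds (show |M| < 1 + |M| * 1 by linarith))]
          with w hw
        by_cases h : ‖(w : Euc m)‖ < 1
        · have hpos : 0 < 1 - ‖(w : Euc m)‖ := by linarith
          have : V₀ w = v₀ (inv w) := if_pos h
          rw [this]
          refine hsub (hM _ ?_)
          simp only [inv]
          rw [norm_smul, norm_inv, Real.norm_of_nonneg hpos.le,
            le_inv_mul_iff₀ hpos]
          nlinarith [le_abs_self M, norm_nonneg (w : Euc m)]
        · have : V₀ w = 0 := if_neg h
          rw [this]; simpa using hε
    have hV₁ : Continuous V₁ := by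
      have hρn : Continuous fun z : Gam m => ρ ‖(z : Euc m)‖ :=
        hρ.comp_continuous continuous_subtype_val.norm fun z => ⟨norm_nonneg _, hnle z⟩
      rw [continuous_iff_continuousAt]
      intro z
      by_cases hz : (z : Euc m) = 0
      · obtain ⟨B, hB⟩ := (isCompact_sphere (0 : Euc m) 1).exists_bound_of_continuousOn hv₁
        have hρ0 : ρ 0 = 0 := by simp [ρ, Real.zero_rpow hp0.ne']
        have hz0 : V₁ z = 0 := by simp [V₁, hz, hρ0]
        rw [ContinuousAt, hz0]
        have hlim : Tendsto (fun w : Gam m => |B| * |ρ ‖(w : Euc m)‖|) (𝓝 z) (𝓝 0) := by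
          have := (hρn.continuousAt (x := z)).tendsto
          simp only [hz, norm_zero, hρ0] at this
          simpa using (this.abs.const_mul |B|)
        refine squeeze_zero_norm (fun w => ?_) hlim
        simp only [V₁, norm_mul, Real.norm_eq_abs]
        by_cases hw : (w : Euc m) = 0
        · simp [hw, hρ0]
        · refine mul_le_mul_of_nonneg_right ?_ (abs_nonneg _)
          refine (hB _ ?_).trans (le_abs_self B)
          rw [mem_sphere_zero_iff_norm, norm_smul, norm_inv, norm_norm,
            inv_mul_cancel₀ (norm_ne_zero_iff.mpr hw)]
      · refine ContinuousAt.mul ?_ hρn.continuousAt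
        have hev : ∀ᶠ w : Gam m in 𝓝 z, (w : Euc m) ≠ 0 :=
          (continuous_subtype_val.continuousAt (x := z)).eventually_ne hz
        have hmem : ∀ w : Gam m, (w : Euc m) ≠ 0 →
            ‖(w : Euc m)‖⁻¹ • (w : Euc m) ∈ Metric.sphere (0 : Euc m) 1 := fun w hw => by
          rw [mem_sphere_zero_iff_norm, norm_smul, norm_inv, norm_norm,
            inv_mul_cancel₀ (norm_ne_zero_iff.mpr hw)]
        refine (hv₁ _ (hmem z hz)).tendsto.comp (tendsto_nhdsWithin_iff.mpr ⟨?_, ?_⟩)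
        · have h : ContinuousAt (fun w : Gam m => ‖(w : Euc m)‖) z := by fun_prop
          exact (h.inv₀ (norm_ne_zero_iff.mpr hz)).smul continuous_subtype_val.continuousAt
        · exact hev.mono fun w hw => hmem w hw
    refine ⟨⟨fun z => c + V₀ z + V₁ z, by fun_prop⟩, fun u => ?_⟩
    have e0 : V₀ (toGam u) = v₀ u := by
      simp only [V₀, inv, if_pos (norm_toGam_lt u), inv_toGam]
    have e1 : V₁ (toGam u) = v₁ (‖u‖⁻¹ • u) * (‖u‖ ^ p / (1 + ‖u‖ ^ p)) := by
      have hu : 0 < 1 + ‖u‖ := by positivity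
      have ha : ‖(toGam u : Euc m)‖⁻¹ • (toGam u : Euc m) = ‖u‖⁻¹ • u := by
        rw [norm_toGam]
        simp only [toGam, smul_smul]
        congr 1
        rw [inv_div, div_eq_mul_inv, mul_comm, ← mul_assoc, inv_mul_cancel₀ hu.ne', one_mul]
      have hb : ρ ‖(toGam u : Euc m)‖ = ‖u‖ ^ p / (1 + ‖u‖ ^ p) := by
        have h1 : 1 - ‖u‖ / (1 + ‖u‖) = 1 / (1 + ‖u‖) := by field_simp; ring
        simp only [ρ]
        rw [norm_toGam, h1, Real.div_rpow (norm_nonneg _) hu.le, Real.div_rpow zero_le_one hu.le,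
          Real.one_rpow]
        have := Real.rpow_pos_of_pos hu p
        have := Real.rpow_nonneg (norm_nonneg u) p
        field_simp
      simp only [V₁, ha, hb]
    simp only [ContinuousMap.coe_mk, e0, e1, hv u]
  · rintro ⟨V, hV⟩
    have hmem : ∀ w : Euc m, w ≠ 0 → ‖‖w‖⁻¹ • w‖ = 1 := fun w hw => by
      rw [norm_smul, norm_inv, norm_norm, inv_mul_cancel₀ (norm_ne_zero_iff.mpr hw)]
    let v₁ : Euc m → ℝ := fun w => if h : ‖w‖ ≤ 1 then V ⟨w, mem_closedBall_zero_iff.mpr h⟩ else 0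
    have hv₁b : ContinuousOn v₁ (Metric.closedBall 0 1) := by
      rw [continuousOn_iff_continuous_domRestrict]
      refine V.continuous.congr fun w => ?_
      have h : ‖(w : Euc m)‖ ≤ 1 := mem_closedBall_zero_iff.mp w.2
      simp [v₁, h]
    have hv₁ : ContinuousOn v₁ (Metric.sphere 0 1) := hv₁b.mono Metric.sphere_subset_closedBall
    have huc := (isCompact_closedBall (0 : Euc m) 1).uniformContinuousOn_of_continuous hv₁b
    obtain ⟨B, hB⟩ := (isCompact_sphere (0 : Euc m) 1).exists_bound_of_continuousOn hv₁
    let g : Euc m → ℝ := fun u => v₁ (‖u‖⁻¹ • u) * (‖u‖ ^ p / (1 + ‖u‖ ^ p))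
    have hfrac : Continuous fun u : Euc m => ‖u‖ ^ p / (1 + ‖u‖ ^ p) := by
      have h : Continuous fun u : Euc m => ‖u‖ ^ p :=
        continuous_norm.rpow_const fun _ => Or.inr hp0.le
      refine h.div (continuous_const.add h) fun u => ?_
      have := Real.rpow_nonneg (norm_nonneg u) p
      positivity
    have hfrac_mem : ∀ u : Euc m, 0 ≤ ‖u‖ ^ p / (1 + ‖u‖ ^ p) ∧ ‖u‖ ^ p / (1 + ‖u‖ ^ p) ≤ 1 := by
      intro u
      have := Real.rpow_nonneg (norm_nonneg u) p
      exact ⟨by positivity, by rw [div_le_one (by positivity)]; linarith⟩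
    have hgb : ∀ u, ‖g u‖ ≤ |B| * |‖u‖ ^ p / (1 + ‖u‖ ^ p)| := by
      intro u
      simp only [g, norm_mul, Real.norm_eq_abs]
      by_cases hw : u = 0
      · simp [hw, Real.zero_rpow hp0.ne']
      · refine mul_le_mul_of_nonneg_right ?_ (abs_nonneg _)
        exact (hB _ (mem_sphere_zero_iff_norm.mpr (hmem u hw))).trans (le_abs_self B)
    have hg : Continuous g := by
      rw [continuous_iff_continuousAt]
      intro u
      by_cases hu : u = 0
      · subst hu
        have hg0 : g 0 = 0 := by simp [g, Real.zero_rpow hp0.ne']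
        rw [ContinuousAt, hg0]
        refine squeeze_zero_norm hgb ?_
        have := (hfrac.continuousAt (x := (0 : Euc m))).tendsto
        simp only [norm_zero, Real.zero_rpow hp0.ne', zero_div] at this
        simpa using this.abs.const_mul |B|
      · refine ContinuousAt.mul ?_ hfrac.continuousAt
        have hev : ∀ᶠ w : Euc m in 𝓝 u, w ≠ 0 := continuousAt_id.eventually_ne hu
        refine (hv₁ _ (mem_sphere_zero_iff_norm.mpr (hmem u hu))).tendsto.comp
          (tendsto_nhdsWithin_iff.mpr ⟨?_, ?_⟩)
        · have h : ContinuousAt (fun w : Euc m => ‖w‖) u := by fun_prop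
          exact (h.inv₀ (norm_ne_zero_iff.mpr hu)).smul continuousAt_id
        · exact hev.mono fun w hw => mem_sphere_zero_iff_norm.mpr (hmem w hw)
    have hgB : ∀ u, ‖g u‖ ≤ |B| := fun u => (hgb u).trans <| by
      rw [abs_of_nonneg (hfrac_mem u).1]
      exact mul_le_of_le_one_right (abs_nonneg B) (hfrac_mem u).2
    let gb : Euc m →ᵇ ℝ := BoundedContinuousFunction.ofNormedAddCommGroup g hg |B| hgB
    refine ⟨0, v - gb, v₁, ?_, hv₁, fun u => ?_⟩
    · rw [← Metric.cobounded_eq_cocompact, ← comap_norm_atTop, Metric.tendsto_nhds]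
      intro ε hε
      obtain ⟨δ, hδ, hδ'⟩ := Metric.uniformContinuousOn_iff.mp huc (ε / 2) (by linarith)
      have l1 : ∀ᶠ r : ℝ in atTop, 1 / (1 + r) < δ := by
        have : Tendsto (fun r : ℝ => 1 / (1 + r)) atTop (𝓝 0) :=
          (tendsto_atTop_add_const_left _ 1 tendsto_id).const_div_atTop 1
        exact this.eventually (gt_mem_nhds hδ)
      have l2 : ∀ᶠ r : ℝ in atTop, |B| * (1 / (1 + r ^ p)) < ε / 2 := by
        have : Tendsto (fun r : ℝ => |B| * (1 / (1 + r ^ p))) atTop (𝓝 (|B| * 0)) :=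
          ((tendsto_atTop_add_const_left _ 1 (tendsto_rpow_atTop hp0)).const_div_atTop 1).const_mul _
        rw [mul_zero] at this
        exact this.eventually (gt_mem_nhds (by linarith))
      filter_upwards [tendsto_comap.eventually l1, tendsto_comap.eventually l2,
        tendsto_comap.eventually (eventually_gt_atTop (0 : ℝ))] with u h1 h2 h3
      have hu : u ≠ 0 := norm_pos_iff.mp h3
      have hpos : 0 < 1 + ‖u‖ := by positivity
      have hpp : 0 ≤ ‖u‖ ^ p := Real.rpow_nonneg (norm_nonneg u) p
      have ev : v u = v₁ (toGam u : Euc m) := by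
        rw [← hV u]
        simp [v₁, (norm_toGam_lt u).le]
      have hd : dist (v₁ (toGam u : Euc m)) (v₁ (‖u‖⁻¹ • u)) < ε / 2 := by
        refine hδ' _ (toGam u).2 _ (mem_closedBall_zero_iff.mpr (hmem u hu).le) ?_
        have : (toGam u : Euc m) - ‖u‖⁻¹ • u = ((1 + ‖u‖)⁻¹ - ‖u‖⁻¹) • u := by
          simp only [toGam, sub_smul]
        rw [dist_eq_norm, this, norm_smul, Real.norm_eq_abs]
        have h4 : (1 + ‖u‖)⁻¹ - ‖u‖⁻¹ = -(1 / ((1 + ‖u‖) * ‖u‖)) := by field_simp; ring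
        rw [h4, abs_neg, abs_of_nonneg (by positivity)]
        calc 1 / ((1 + ‖u‖) * ‖u‖) * ‖u‖ = 1 / (1 + ‖u‖) := by field_simp
          _ < δ := h1
      have hsplit : v u - g u = (v₁ (toGam u : Euc m) - v₁ (‖u‖⁻¹ • u))
          + v₁ (‖u‖⁻¹ • u) * (1 / (1 + ‖u‖ ^ p)) := by
        simp only [g, ev]
        have : 1 + ‖u‖ ^ p ≠ 0 := by positivity
        field_simp
        ring
      have hb : |v₁ (‖u‖⁻¹ • u) * (1 / (1 + ‖u‖ ^ p))| ≤ |B| * (1 / (1 + ‖u‖ ^ p)) := by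
        rw [abs_mul, abs_of_nonneg (by positivity : 0 ≤ 1 / (1 + ‖u‖ ^ p))]
        refine mul_le_mul_of_nonneg_right ?_ (by positivity)
        exact (hB _ (mem_sphere_zero_iff_norm.mpr (hmem u hu))).trans (le_abs_self B)
      have : (v - gb) u = v u - g u := rfl
      rw [this, Real.dist_eq, sub_zero, hsplit]
      rw [Real.dist_eq] at hd
      exact (abs_add_le _ _).trans_lt (by linarith)
    · change v u = 0 + (v u - g u) + g u
      ring

/-! ### DiPerna–Majda measures -/

/-- `(σ, ν)` is attained by a sequence in `L^p([t₀, t_f]; ℝᵐ)`. -/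
structure IsDiPernaMajda (t₀ tf p : ℝ) {m : ℕ} (σ : Measure ℝ) (ν : Kernel ℝ (Gam m)) : Prop where
  supported : σ (Icc t₀ tf)ᶜ = 0
  attained : ∃ u : ℕ → ℝ → Euc m,
    (∀ k, MemLp (u k) (ENNReal.ofReal p) (volume.restrict (Icc t₀ tf))) ∧
    ∀ h₀ : ℝ × Gam m → ℝ, ContinuousOn h₀ (Icc t₀ tf ×ˢ univ) →
      Tendsto (fun k => ∫ t in Icc t₀ tf, h₀ (t, toGam (u k t)) * (1 + ‖u k t‖ ^ p)) atTop
        (𝓝 (∫ t, ∫ z, h₀ (t, z) ∂(ν t) ∂σ))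

/-! ### The dynamics `f = c + d` -/

/-- Regularity and growth of the dynamics `f(t,y,u) = c(t,y,u) + d(t,u)`. -/
structure DynamicsAssumption (t₀ tf p : ℝ) {n m : ℕ} (Y : Set (Euc n))
    (c : ℝ → Euc n → Euc m → Euc n) (d : ℝ → Euc m → Euc n) : Prop where
  caratheodory_continuous : ∀ᵐ t ∂(volume.restrict (Icc t₀ tf)),
    ContinuousOn (fun q : Euc n × Euc m => c t q.1 q.2) (Y ×ˢ univ)
  caratheodory_measurable : ∀ y ∈ Y, ∀ u,
    AEMeasurable (fun t => c t y u) (volume.restrict (Icc t₀ tf))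
  growth : ∃ (ε β : ℝ) (α₁ α₂ : ℝ → ℝ), 0 < ε ∧
    MemLp α₁ 1 (volume.restrict (Icc t₀ tf)) ∧
    MemLp α₂ (ENNReal.ofReal (1 + ε)) (volume.restrict (Icc t₀ tf)) ∧
    (∀ t ∈ Icc t₀ tf, ∀ y ∈ Y, ∀ u,
      ‖c t y u‖ ≤ α₂ t + β * (‖y‖ ^ (1 / ε) + ‖u‖ ^ (p / (1 + ε)))) ∧
    (∀ t ∈ Icc t₀ tf, ∀ y ∈ Y, ∀ u, ‖c t y u‖ ≤ (α₁ t + β * ‖u‖ ^ p) * (1 + ‖y‖)) ∧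
    (∀ t ∈ Icc t₀ tf, ∀ y₁ ∈ Y, ∀ y₂ ∈ Y, ∀ u,
      ‖c t y₁ u - c t y₂ u‖ ≤
        (α₁ t + β * ‖y₁‖ ^ (1 / ε) + β * ‖y₂‖ ^ (1 / ε) + β * ‖u‖ ^ (p / (1 + ε))) *
          ‖y₁ - y₂‖)
  /-- `d₀(t,u) = d(t,u) / (1 + |u|^p)` belongs to `C([t₀, t_f]; 𝓡ⁿ)`. -/
  d_ring : ∃ d₀ : ℝ → Fin n → (Euc m →ᵇ ℝ),
    (∀ i, ContinuousOn (fun t => d₀ t i) (Icc t₀ tf)) ∧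
    (∀ t ∈ Icc t₀ tf, ∀ i, d₀ t i ∈ sphereRing p m) ∧
    ∀ t ∈ Icc t₀ tf, ∀ i u, d₀ t i u = d t u i / (1 + ‖u‖ ^ p)

/-- The function `1 / (1 + |u|^p)` on `γℝᵐ`. -/
def weight (p : ℝ) {m : ℕ} : Gam m → ℝ :=
  extGam fun u => 1 / (1 + ‖u‖ ^ p)

/-- The function `f(t,y,u) / (1 + |u|^p)`, extended in `u` to `γℝᵐ`. -/
def scaledField (p : ℝ) {n m : ℕ} (f : ℝ → Euc n → Euc m → Euc n) (t : ℝ) (y : Euc n) :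
    Gam m → Euc n :=
  extGam fun u => (1 + ‖u‖ ^ p)⁻¹ • f t y u

/-! ### States, space-time reparametrization and relaxed arcs -/

/-- `y ∈ BV([t₀, t_f]; Y)`, with `y` extended by constants outside `[t₀, t_f]`, so that jumps
at `t₀` and `t_f` are allowed; `y(s⁻)`, `y(s⁺)` are `Function.leftLim y s`,
`Function.rightLim y s`. -/
structure IsBVState (t₀ tf : ℝ) {n : ℕ} (Y : Set (Euc n)) (y : ℝ → Euc n) : Prop where
  bv : BoundedVariationOn y univ
  const_left : ∃ a, ∀ t < t₀, y t = a
  const_right : ∃ b, ∀ t > tf, y t = b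
  mem : ∀ t ∈ Icc t₀ tf, y t ∈ Y

/-- The set `J` of atoms of `σ`. -/
def atoms (σ : Measure ℝ) : Set ℝ := {s | σ {s} ≠ 0}

/-- The part of `σ` without atoms. -/
def contPart (σ : Measure ℝ) : Measure ℝ := σ.restrict (atoms σ)ᶜ

/-- `y` solves the relaxed differential equation driven by `(σ, ν)`, with the space-time
reparametrization `(ys s)_{s ∈ J}`: at each atom `s` of `σ` the fictitious state `ys s` runs inside
`Y` from `y(s⁻)` to `y(s⁺)` during the fictitious time interval `[0, σ({s})]`. -/
structure IsSpaceTimeSolution (t₀ tf p : ℝ) {n m : ℕ} (Y : Set (Euc n))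
    (f : ℝ → Euc n → Euc m → Euc n) (σ : Measure ℝ) (ν : Kernel ℝ (Gam m))
    (y : ℝ → Euc n) (ys : ℝ → ℝ → Euc n) : Prop where
  integral_eq : ∀ τ ∈ Icc t₀ tf,
    Function.rightLim y τ = Function.leftLim y t₀
      + (∫ t in Icc t₀ τ, (∫ z, scaledField p f t (y t) z ∂(ν t)) ∂(contPart σ))
      + ∑' s : (atoms σ ∩ Icc t₀ τ : Set ℝ), (Function.rightLim y s - Function.leftLim y s)
  jump_ode : ∀ s ∈ atoms σ, ∀ r ∈ Icc 0 (σ.real {s}),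
    HasDerivWithinAt (ys s) (∫ z, scaledField p f s (ys s r) z ∂(ν s)) (Icc 0 (σ.real {s})) r
  jump_start : ∀ s ∈ atoms σ, ys s 0 = Function.leftLim y s
  jump_end : ∀ s ∈ atoms σ, ys s (σ.real {s}) = Function.rightLim y s
  jump_mem : ∀ s ∈ atoms σ, ∀ r ∈ Icc 0 (σ.real {s}), ys s r ∈ Y

/-- `(σ, ν, y)` is an admissible relaxed arc from `y₀` to `yf`, with associated space-time
reparametrization `ys`. -/
structure IsRelaxedArc (t₀ tf p : ℝ) {n m : ℕ} (Y : Set (Euc n))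
    (f : ℝ → Euc n → Euc m → Euc n) (y₀ yf : Euc n) (σ : Measure ℝ) (ν : Kernel ℝ (Gam m))
    (y : ℝ → Euc n) (ys : ℝ → ℝ → Euc n) : Prop where
  control : IsDiPernaMajda t₀ tf p σ ν
  state : IsBVState t₀ tf Y y
  solution : IsSpaceTimeSolution t₀ tf p Y f σ ν y ys
  initial : Function.leftLim y t₀ = y₀
  terminal : Function.rightLim y tf = yf

/-! ### The occupation measure -/

open Classical in
/-- The conditional distribution `ξ(dy | t)` of the state. -/
def stateLaw {n : ℕ} (σ : Measure ℝ) (y : ℝ → Euc n) (ys : ℝ → ℝ → Euc n) (t : ℝ) :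
    Measure (Euc n) :=
  if t ∈ atoms σ then
    (σ {t})⁻¹ • (volume.restrict (Icc 0 (σ.real {t}))).map (ys t)
  else Measure.dirac (y t)

/-- The occupation measure `dμ(t,y,u) = ξ(dy | t) ν(du | t) σ(dt)`. -/
def occupationMeasure {n m : ℕ} (σ : Measure ℝ) (ν : Kernel ℝ (Gam m))
    (y : ℝ → Euc n) (ys : ℝ → ℝ → Euc n) : Measure (ℝ × Euc n × Gam m) :=
  σ.bind fun t => (Measure.dirac t).prod ((stateLaw σ y ys t).prod (ν t))

end DiPernaMajda

end

namespace DiPernaMajda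

/-! ### Extension by continuity to the compactification -/

/-! The argument rests on two facts about control at infinity. First, testing the defining limit of
the DiPerna–Majda measure against `g(t) / (1 + |u|^p)` shows that `weightMean p ν` is the density of
Lebesgue measure on `T` with respect to `σ` (`IsDiPernaMajda.withDensity_weightMean`). Hence at an
atom of `σ`, and `σ`-almost everywhere on any Lebesgue-null set of times, `ν(· | t)` lives on the
sphere at infinity. Second, `c` grows in `u` with exponent `p / (1 + ε) < p`, so on that sphere the
scaled field reduces to the extension of `d / (1 + |u|^p)` and does not see the state
(`DynamicsAssumption.scaledField_of_norm_eq_one`).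

Consequently the fictitious state moves with constant velocity, each jump is a straight segment, and
its increment is `σ({s})` times the mean field. The sum of jumps merges with the integral against
`σ_C`, so that `t ↦ (t, y(t⁺))` is a primitive of `(weightMean, meanField)` with respect to the
whole of `σ` (`IsRelaxedArc.graph_eq`). The chain rule `sub_eq_setIntegral_meanDeriv` then expresses
the increment of `v` as a `σ`-integral in which the derivative is averaged over the segment from
`(t, y(t⁻))` to `(t, y(t⁺))`.

The occupation measure performs the same averaging: it is the image of `σ ⊗ (Lebesgue on [0, 1] ×
ν)` under the parametrization of these segments (`IsRelaxedArc.occupationMeasure_eq_map`), which are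
degenerate for `σ`-almost every `t` outside the atoms. Fubini identifies the two integrals
(`IsRelaxedArc.integral_fderiv`). -/

theorem comap_toGam_neBot {m : ℕ} (z : Gam m) : (comap (toGam (m := m)) (𝓝 z)).NeBot :=
  (IsDenseInducing.mk isEmbedding_toGam.isInducing denseRange_toGam).comap_nhds_neBot z

theorem extGam_eq_of_tendsto {m : ℕ} {X : Type*} [TopologicalSpace X] [T2Space X] [Nonempty X]
    {g : Euc m → X} {z : Gam m} {a : X} (h : Tendsto g (comap toGam (𝓝 z)) (𝓝 a)) :
    extGam g z = a :=
  have := comap_toGam_neBot z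
  h.limUnder_eq

theorem extGam_toGam {m : ℕ} {X : Type*} [TopologicalSpace X] [T2Space X] [Nonempty X]
    {g : Euc m → X} {u : Euc m} (h : ContinuousAt g u) : extGam g (toGam u) = g u := by
  refine extGam_eq_of_tendsto ?_
  rw [← isEmbedding_toGam.nhds_eq_comap u]
  exact h

theorem extGam_eq_of_continuousAt {m : ℕ} {X : Type*} [TopologicalSpace X] [T2Space X] [Nonempty X]
    {g : Euc m → X} {V : Gam m → X} {z : Gam m} (hV : ContinuousAt V z)
    (h : ∀ u, V (toGam u) = g u) : extGam g z = V z :=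
  extGam_eq_of_tendsto ((hV.tendsto.comp tendsto_comap).congr h)

theorem tendsto_norm_comap_toGam {m : ℕ} {z : Gam m} (hz : ‖(z : Euc m)‖ = 1) :
    Tendsto (fun u : Euc m => ‖u‖) (comap toGam (𝓝 z)) atTop := by
  refine tendsto_atTop.mpr fun b => ?_
  have h1 : Tendsto (fun w : Gam m => ‖(w : Euc m)‖) (𝓝 z) (𝓝 1) :=
    (continuous_subtype_val.norm.tendsto' z 1 hz)
  -- The image norm is `r / (1 + r)` with `r = |u|`, increasing on `r ≥ 0`; replacing `b` by `|b|`
  -- keeps the threshold in that range.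
  have hb : |b| / (1 + |b|) < 1 := by
    rw [div_lt_one (by positivity)]; linarith
  filter_upwards [(h1.comp tendsto_comap).eventually (lt_mem_nhds hb)] with u hu
  simp only [Function.comp_apply, norm_toGam] at hu
  rw [div_lt_div_iff₀ (by positivity) (by positivity)] at hu
  nlinarith [le_abs_self b, norm_nonneg u]

theorem exists_toGam_eq {m : ℕ} {z : Gam m} (hz : ‖(z : Euc m)‖ ≠ 1) : ∃ u, toGam u = z :=
  ⟨_, toGam_inv z (lt_of_le_of_ne (mem_closedBall_zero_iff.mp z.2) hz)⟩

/-! ### The weight -/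

theorem one_add_norm_rpow_pos {m : ℕ} (p : ℝ) (u : Euc m) : 0 < 1 + ‖u‖ ^ p := by
  have := Real.rpow_nonneg (norm_nonneg u) p
  positivity

theorem continuous_norm_rpow {p : ℝ} (hp : 1 ≤ p) {m : ℕ} :
    Continuous fun u : Euc m => ‖u‖ ^ p :=
  continuous_norm.rpow_const fun _ => Or.inr (by linarith)

theorem exists_continuousMap_weight {p : ℝ} (hp : 1 ≤ p) (m : ℕ) :
    ∃ V : C(Gam m, ℝ), ∀ u, V (toGam u) = 1 / (1 + ‖u‖ ^ p) := by
  have hpos := fun u : Euc m => one_add_norm_rpow_pos p u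
  have hc : Continuous fun u : Euc m => 1 / (1 + ‖u‖ ^ p) :=
    continuous_const.div (continuous_const.add (continuous_norm_rpow hp)) fun u => (hpos u).ne'
  have hb : ∀ u : Euc m, ‖1 / (1 + ‖u‖ ^ p)‖ ≤ 1 := fun u => by
    rw [Real.norm_of_nonneg (by have := hpos u; positivity), div_le_one (hpos u)]
    linarith [Real.rpow_nonneg (norm_nonneg u) p]
  refine (mem_sphereRing_iff hp (BoundedContinuousFunction.ofNormedAddCommGroup _ hc 1 hb)).mp
    -- The decomposition is `1 / (1 + |u|^p) = 1 + 0 - |u|^p / (1 + |u|^p)`.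
    ⟨1, 0, fun _ => -1, tendsto_const_nhds, continuousOn_const, fun u => ?_⟩
  have := (hpos u).ne'
  simp only [BoundedContinuousFunction.coe_ofNormedAddCommGroup,
    BoundedContinuousFunction.coe_zero, Pi.zero_apply]
  field_simp
  ring

theorem continuous_weight {p : ℝ} (hp : 1 ≤ p) {m : ℕ} : Continuous (weight p : Gam m → ℝ) := by
  obtain ⟨V, hV⟩ := exists_continuousMap_weight hp m
  have : (weight p : Gam m → ℝ) = V :=
    funext fun z => extGam_eq_of_continuousAt V.continuous.continuousAt hV
  exact this ▸ V.continuous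

theorem weight_toGam {p : ℝ} (hp : 1 ≤ p) {m : ℕ} (u : Euc m) :
    weight p (toGam u) = 1 / (1 + ‖u‖ ^ p) := by
  obtain ⟨V, hV⟩ := exists_continuousMap_weight hp m
  exact (extGam_eq_of_continuousAt V.continuous.continuousAt hV).trans (hV u)

theorem weight_mem_Icc {p : ℝ} (hp : 1 ≤ p) {m : ℕ} (z : Gam m) : weight p z ∈ Icc (0 : ℝ) 1 := by
  refine denseRange_toGam.induction_on (p := fun z => weight p z ∈ Icc (0 : ℝ) 1) z
    (isClosed_Icc.preimage (continuous_weight hp)) fun u => ?_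
  rw [weight_toGam hp]
  have h := one_add_norm_rpow_pos p u
  exact ⟨by positivity, (div_le_one h).mpr (by linarith [Real.rpow_nonneg (norm_nonneg u) p])⟩

theorem norm_eq_one_of_weight_eq_zero {p : ℝ} (hp : 1 ≤ p) {m : ℕ} {z : Gam m}
    (hz : weight p z = 0) : ‖(z : Euc m)‖ = 1 := by
  by_contra h
  obtain ⟨u, rfl⟩ := exists_toGam_eq h
  rw [weight_toGam hp] at hz
  have := one_add_norm_rpow_pos p u
  exact absurd hz (by positivity)

theorem weight_eq_zero_of_norm_eq_one {p : ℝ} (hp : 1 ≤ p) {m : ℕ} {z : Gam m}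
    (hz : ‖(z : Euc m)‖ = 1) : weight p z = 0 := by
  have h : Tendsto (fun r : ℝ => 1 / (1 + r ^ p)) atTop (𝓝 0) :=
    (tendsto_atTop_add_const_left _ 1 (tendsto_rpow_atTop (by linarith))).const_div_atTop 1
  exact extGam_eq_of_tendsto (h.comp (tendsto_norm_comap_toGam hz))

/-! ### The scaled field -/

section Field

variable {t₀ tf p : ℝ} {n m : ℕ} {Y : Set (Euc n)}
  {c : ℝ → Euc n → Euc m → Euc n} {d : ℝ → Euc m → Euc n}

/-- The part `d / (1 + |u|^p)` of the scaled field extends to a bounded measurable function on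
`ℝ × γℝᵐ`, continuous in the second variable. -/
theorem DynamicsAssumption.exists_extension (hf : DynamicsAssumption t₀ tf p Y c d) (hp : 1 ≤ p) :
    ∃ D : ℝ → Gam m → Euc n, Measurable (Function.uncurry D) ∧ (∀ t, Continuous (D t)) ∧
      (∃ C, ∀ t z, ‖D t z‖ ≤ C) ∧
      ∀ t ∈ Icc t₀ tf, ∀ u, D t (toGam u) = (1 + ‖u‖ ^ p)⁻¹ • d t u := by
  classical
  obtain ⟨d₀, hcont, hring, hd₀⟩ := hf.d_ring
  -- Setting the coordinates to zero for `t` outside `T` makes the bound and the joint measurability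
  -- global in `t`.
  have hV : ∀ (t : ℝ) (i : Fin n), ∃ V : C(Gam m, ℝ),
      ∀ u, V (toGam u) = (Icc t₀ tf).indicator (fun t => d₀ t i u) t := by
    intro t i
    by_cases ht : t ∈ Icc t₀ tf
    · obtain ⟨V, hV⟩ := (mem_sphereRing_iff hp _).mp (hring t ht i)
      exact ⟨V, fun u => by rw [hV, indicator_of_mem ht]⟩
    · exact ⟨0, fun u => by rw [indicator_of_notMem ht]; rfl⟩
  choose V hV using hV
  have hbd : ∀ i, ∃ C, ∀ t ∈ Icc t₀ tf, ‖d₀ t i‖ ≤ C := fun i =>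
    isCompact_Icc.exists_bound_of_continuousOn (hcont i)
  choose C hC using hbd
  have hVC : ∀ t i z, |V t i z| ≤ |C i| := by
    intro t i z
    refine denseRange_toGam.induction_on (p := fun z => |V t i z| ≤ |C i|) z
      (isClosed_le (V t i).continuous.abs continuous_const) fun u => ?_
    rw [hV]
    by_cases ht : t ∈ Icc t₀ tf
    · rw [indicator_of_mem ht]
      exact ((d₀ t i).norm_coe_le_norm u).trans ((hC i t ht).trans (le_abs_self _))
    · rw [indicator_of_notMem ht, abs_zero]; exact abs_nonneg _
  have hmeas : ∀ i, Measurable (Function.uncurry fun (z : Gam m) (t : ℝ) => V t i z) := by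
    intro i
    refine measurable_uncurry_of_continuous_of_measurable (fun t => (V t i).continuous) fun z => ?_
    -- The dependence on `t` is known only at finite points; measurability at a point at infinity
    -- comes from a sequence of finite points converging to it.
    obtain ⟨w, hw, hwz⟩ := mem_closure_iff_seq_limit.mp (denseRange_toGam z)
    choose u hu using hw
    refine measurable_of_tendsto_metrizable (f := fun k t => V t i (w k)) (fun k => ?_)
      (tendsto_pi_nhds.mpr fun t => ((V t i).continuous.tendsto z).comp hwz)
    simp only [← hu, hV]
    have h : ContinuousOn (fun t => d₀ t i (u k)) (Icc t₀ tf) := fun t ht =>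
      ((continuous_eval_const (F := Euc m →ᵇ ℝ) (u k)).continuousAt.comp_continuousWithinAt
        (hcont i t ht))
    have h' := h.measurable_piecewise (g := 0) continuousOn_const measurableSet_Icc
    rwa [piecewise_eq_indicator] at h'
  refine ⟨fun t z => ∑ i, V t i z • EuclideanSpace.single i (1 : ℝ), ?_, fun t => ?_,
    ⟨∑ i, |C i|, fun t z => ?_⟩, fun t ht u => ?_⟩
  · refine Finset.measurable_sum _ fun i _ => ?_
    exact ((hmeas i).comp measurable_swap).smul_const _
  · exact continuous_finsetSum _ fun i _ => (V t i).continuous.smul continuous_const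
  · refine (norm_sum_le _ _).trans (Finset.sum_le_sum fun i _ => ?_)
    rw [norm_smul, PiLp.norm_single, norm_one, mul_one]
    exact hVC t i z
  · ext j
    simp [hV, indicator_of_mem ht, hd₀ t ht, div_eq_inv_mul, Pi.single_apply]

/-- On the sphere at infinity, the scaled field does not depend on the state. -/
theorem DynamicsAssumption.scaledField_of_norm_eq_one (hf : DynamicsAssumption t₀ tf p Y c d)
    (hp : 1 ≤ p) {f : ℝ → Euc n → Euc m → Euc n} (hcd : ∀ t y u, f t y u = c t y u + d t u)
    {D : Gam m → Euc n} (hD : Continuous D) {t : ℝ} (ht : t ∈ Icc t₀ tf)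
    (hDd : ∀ u, D (toGam u) = (1 + ‖u‖ ^ p)⁻¹ • d t u)
    {y : Euc n} (hy : y ∈ Y) {z : Gam m} (hz : ‖(z : Euc m)‖ = 1) :
    scaledField p f t y z = D z := by
  refine extGam_eq_of_tendsto ?_
  have hlim := tendsto_norm_comap_toGam hz
  obtain ⟨ε, β, α₁, α₂, hε, -, -, hgrowth, -, -⟩ := hf.growth
  have h1 : Tendsto (fun u => (1 + ‖u‖ ^ p)⁻¹ • c t y u) (comap toGam (𝓝 z)) (𝓝 0) := by
    have hp0 : 0 < p := by linarith
    have hq : p / (1 + ε) < p := by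
      rw [div_lt_iff₀ (by linarith)]; nlinarith
    -- After division by `|u|^p`, the first growth condition leaves only negative powers of `|u|`,
    -- because `p / (1 + ε) < p`.
    have a1 : Tendsto (fun r : ℝ => (|α₂ t| + |β| * ‖y‖ ^ (1 / ε)) * r ^ (-p)
        + |β| * r ^ (-(p - p / (1 + ε)))) atTop
        (𝓝 ((|α₂ t| + |β| * ‖y‖ ^ (1 / ε)) * 0 + |β| * 0)) :=
      ((tendsto_rpow_neg_atTop hp0).const_mul _).add
        ((tendsto_rpow_neg_atTop (sub_pos.mpr hq)).const_mul _)
    simp only [mul_zero, add_zero] at a1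
    refine squeeze_zero_norm' ?_ (a1.comp hlim)
    filter_upwards [hlim.eventually_gt_atTop 0] with u hu
    have hup : 0 < ‖u‖ ^ p := Real.rpow_pos_of_pos hu p
    have huq : 0 < ‖u‖ ^ (p / (1 + ε)) := Real.rpow_pos_of_pos hu _
    have hye : 0 ≤ ‖y‖ ^ (1 / ε) := Real.rpow_nonneg (norm_nonneg y) _
    rw [norm_smul, norm_inv, Real.norm_of_nonneg (one_add_norm_rpow_pos p u).le]
    have b1 : ‖c t y u‖ ≤ |α₂ t| + |β| * ‖y‖ ^ (1 / ε) + |β| * ‖u‖ ^ (p / (1 + ε)) := by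
      refine (hgrowth t ht y hy u).trans ?_
      nlinarith [le_abs_self (α₂ t), le_abs_self β, mul_le_mul_of_nonneg_right (le_abs_self β) hye,
        mul_le_mul_of_nonneg_right (le_abs_self β) huq.le]
    calc (1 + ‖u‖ ^ p)⁻¹ * ‖c t y u‖
        ≤ (‖u‖ ^ p)⁻¹ * (|α₂ t| + |β| * ‖y‖ ^ (1 / ε) + |β| * ‖u‖ ^ (p / (1 + ε))) := by
          refine mul_le_mul ?_ b1 (norm_nonneg _) (by positivity)
          exact inv_anti₀ hup (by linarith)
      _ = _ := by
          simp only [Function.comp_apply]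
          rw [neg_sub, Real.rpow_sub hu, Real.rpow_neg hu.le]
          ring
  have h2 := h1.add ((hD.tendsto z).comp tendsto_comap)
  rw [zero_add] at h2
  refine h2.congr fun u => ?_
  rw [Function.comp_apply, hDd, hcd, smul_add]

/-- At finite points, the extension by continuity is the field itself. -/
theorem scaledField_toGam (hp : 1 ≤ p) {f : ℝ → Euc n → Euc m → Euc n}
    (hcd : ∀ t y u, f t y u = c t y u + d t u)
    {D : Gam m → Euc n} (hD : Continuous D) {t : ℝ}
    (hDd : ∀ u, D (toGam u) = (1 + ‖u‖ ^ p)⁻¹ • d t u) {y : Euc n} (hc : Continuous (c t y))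
    (u : Euc m) :
    scaledField p f t y (toGam u) = (1 + ‖u‖ ^ p)⁻¹ • c t y u + D (toGam u) := by
  have he : (fun u => (1 + ‖u‖ ^ p)⁻¹ • f t y u)
      = fun u => (1 + ‖u‖ ^ p)⁻¹ • c t y u + D (toGam u) := by
    funext u
    rw [hDd, hcd, smul_add]
  have hcont : Continuous fun u => (1 + ‖u‖ ^ p)⁻¹ • c t y u + D (toGam u) :=
    (((continuous_const.add (continuous_norm_rpow hp)).inv₀
      fun u => (one_add_norm_rpow_pos p u).ne').smul hc).add (hD.comp continuous_toGam)
  unfold scaledField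
  rw [he, extGam_toGam hcont.continuousAt]

end Field

end DiPernaMajda

namespace DiPernaMajda

/-! ### The first marginal of a DiPerna–Majda measure -/

/-- The mean of the weight under `ν(· | t)`, which is the density of Lebesgue measure with respect
to `σ`. -/
noncomputable def weightMean (p : ℝ) {m : ℕ} (ν : Kernel ℝ (Gam m)) (t : ℝ) : ℝ :=
  ∫ z, weight p z ∂(ν t)

section Control

variable {t₀ tf p : ℝ} {m : ℕ} {σ : Measure ℝ} {ν : Kernel ℝ (Gam m)}

theorem measurable_weightMean (hp : 1 ≤ p) (ν : Kernel ℝ (Gam m)) [IsMarkovKernel ν] :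
    Measurable (weightMean p ν) :=
  ((continuous_weight hp).stronglyMeasurable.integral_kernel).measurable

theorem integrable_weight (hp : 1 ≤ p) (κ : Measure (Gam m)) [IsFiniteMeasure κ] :
    Integrable (weight p) κ :=
  Integrable.of_bound (continuous_weight hp).aestronglyMeasurable 1 <| ae_of_all _ fun z => by
    rw [Real.norm_of_nonneg (weight_mem_Icc hp z).1]
    exact (weight_mem_Icc hp z).2

theorem weightMean_nonneg (hp : 1 ≤ p) (ν : Kernel ℝ (Gam m)) (t : ℝ) : 0 ≤ weightMean p ν t :=
  integral_nonneg fun z => (weight_mem_Icc hp z).1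

theorem weightMean_le_one (hp : 1 ≤ p) (ν : Kernel ℝ (Gam m)) [IsMarkovKernel ν] (t : ℝ) :
    weightMean p ν t ≤ 1 := by
  have := integral_mono (integrable_weight hp (ν t)) (integrable_const (1 : ℝ))
    fun z => (weight_mem_Icc hp z).2
  simpa [weightMean] using this

theorem ae_norm_eq_one_of_weightMean_eq_zero (hp : 1 ≤ p) [IsMarkovKernel ν] {t : ℝ}
    (h : weightMean p ν t = 0) : ∀ᵐ z : Gam m ∂(ν t), ‖(z : Euc m)‖ = 1 := by
  have := (integral_eq_zero_iff_of_nonneg (fun z => (weight_mem_Icc hp z).1)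
    (integrable_weight hp (ν t))).mp h
  exact this.mono fun z hz => norm_eq_one_of_weight_eq_zero hp hz

theorem integrable_weightMean (hp : 1 ≤ p) [IsMarkovKernel ν] [IsFiniteMeasure σ] :
    Integrable (weightMean p ν) σ :=
  Integrable.of_bound (measurable_weightMean hp ν).aestronglyMeasurable 1 <| ae_of_all _ fun t => by
    rw [Real.norm_of_nonneg (weightMean_nonneg hp ν t)]
    exact weightMean_le_one hp ν t

/-- For the test function `g(t) · weight p u` the factor `1 + |u_k|^p` cancels, so the sequence in
`attained` is constantly `∫_T g`; its limit is the integral of `g` against the weighted `σ`. -/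
theorem IsDiPernaMajda.withDensity_weightMean (h : IsDiPernaMajda t₀ tf p σ ν) (hp : 1 ≤ p)
    [IsMarkovKernel ν] [IsFiniteMeasure σ] :
    σ.withDensity (fun t => ENNReal.ofReal (weightMean p ν t)) = volume.restrict (Icc t₀ tf) := by
  have : IsFiniteMeasure (σ.withDensity (fun t => ENNReal.ofReal (weightMean p ν t))) :=
    isFiniteMeasure_withDensity_ofReal (integrable_weightMean hp).2
  refine ext_of_forall_integral_eq_of_IsFiniteMeasure fun g => ?_
  obtain ⟨u, -, hu⟩ := h.attained
  have h1 := hu (fun q => g q.1 * weight p q.2) (by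
    have := continuous_weight hp (m := m)
    exact (Continuous.mul (by fun_prop) (by fun_prop)).continuousOn)
  have h2 : ∀ k, ∫ t in Icc t₀ tf, g t * weight p (toGam (u k t)) * (1 + ‖u k t‖ ^ p)
      = ∫ t in Icc t₀ tf, g t := fun k => by
    congr 1
    funext t
    have := (one_add_norm_rpow_pos p (u k t)).ne'
    rw [weight_toGam hp]
    field_simp
  simp only [h2] at h1
  rw [tendsto_nhds_unique tendsto_const_nhds h1, integral_withDensity_eq_integral_toReal_smul
    (measurable_weightMean hp ν).ennreal_ofReal (ae_of_all _ fun _ => ENNReal.ofReal_lt_top)]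
  congr 1
  funext t
  rw [integral_const_mul, ENNReal.toReal_ofReal (weightMean_nonneg hp ν t), smul_eq_mul, mul_comm]
  rfl

/-- `σ` may charge Lebesgue-null sets, on which the Carathéodory conditions can fail. This is
harmless: at almost all such times the control sits at infinity, where `c` plays no role. -/
theorem IsDiPernaMajda.ae_weightMean_eq_zero (h : IsDiPernaMajda t₀ tf p σ ν) (hp : 1 ≤ p)
    [IsMarkovKernel ν] [IsFiniteMeasure σ] {N : Set ℝ}
    (hN : volume.restrict (Icc t₀ tf) N = 0) : ∀ᵐ t ∂σ, t ∈ N → weightMean p ν t = 0 := by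
  rw [← h.withDensity_weightMean hp] at hN
  have h1 : ∀ᵐ t ∂(σ.withDensity fun t => ENNReal.ofReal (weightMean p ν t)), t ∉ N :=
    measure_eq_zero_iff_ae_notMem.mp hN
  rw [ae_withDensity_iff (measurable_weightMean hp ν).ennreal_ofReal] at h1
  filter_upwards [h1] with t ht htN
  by_contra hne
  refine ht ?_ htN
  rw [Ne, ENNReal.ofReal_eq_zero, not_le]
  exact lt_of_le_of_ne (weightMean_nonneg hp ν t) (Ne.symm hne)

theorem IsDiPernaMajda.weightMean_eq_zero_of_mem_atoms (h : IsDiPernaMajda t₀ tf p σ ν)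
    (hp : 1 ≤ p) [IsMarkovKernel ν] [IsFiniteMeasure σ] {s : ℝ} (hs : s ∈ atoms σ) :
    weightMean p ν s = 0 := by
  have h0 : volume.restrict (Icc t₀ tf) {s} = 0 :=
    le_antisymm ((Measure.restrict_apply_le _ _).trans (by simp)) zero_le
  have := h.ae_weightMean_eq_zero hp h0
  by_contra hne
  refine hs (measure_mono_null ?_ this)
  rintro t rfl
  simpa using hne

theorem IsDiPernaMajda.atoms_subset (h : IsDiPernaMajda t₀ tf p σ ν) : atoms σ ⊆ Icc t₀ tf := by
  intro s hs
  by_contra hn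
  exact hs (measure_mono_null (singleton_subset_iff.mpr hn) h.supported)

theorem IsDiPernaMajda.ae_mem (h : IsDiPernaMajda t₀ tf p σ ν) : ∀ᵐ t ∂σ, t ∈ Icc t₀ tf :=
  h.supported

theorem IsDiPernaMajda.setIntegral_weightMean (h : IsDiPernaMajda t₀ tf p σ ν) (hp : 1 ≤ p)
    [IsMarkovKernel ν] [IsFiniteMeasure σ] {s : Set ℝ} (hs : MeasurableSet s)
    (hsub : s ⊆ Icc t₀ tf) : ∫ t in s, weightMean p ν t ∂σ = volume.real s := by
  have h1 := setIntegral_withDensity_eq_setIntegral_toReal_smul (μ := σ)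
    (measurable_weightMean hp ν).ennreal_ofReal (ae_of_all _ fun _ => ENNReal.ofReal_lt_top)
    (fun _ => (1 : ℝ)) hs
  rw [h.withDensity_weightMean hp, Measure.restrict_restrict hs, inter_eq_left.mpr hsub] at h1
  simp only [ENNReal.toReal_ofReal (weightMean_nonneg hp ν _), smul_eq_mul, mul_one,
    integral_const, measureReal_restrict_apply_univ] at h1
  exact h1.symm

/-- Transfers the `L¹(T)` majorant of `c` to `σ`, for which it need not be integrable without the
weight. -/
theorem IsDiPernaMajda.integrable_weightMean_mul (h : IsDiPernaMajda t₀ tf p σ ν) (hp : 1 ≤ p)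
    [IsMarkovKernel ν] [IsFiniteMeasure σ] {g : ℝ → ℝ}
    (hg : Integrable g (volume.restrict (Icc t₀ tf))) :
    Integrable (fun t => weightMean p ν t * g t) σ := by
  rw [← h.withDensity_weightMean hp, integrable_withDensity_iff_integrable_smul'
    (measurable_weightMean hp ν).ennreal_ofReal (ae_of_all _ fun _ => ENNReal.ofReal_lt_top)] at hg
  simpa only [ENNReal.toReal_ofReal (weightMean_nonneg hp ν _), smul_eq_mul] using hg

theorem countable_atoms [IsFiniteMeasure σ] : (atoms σ).Countable :=
  Measure.countable_meas_pos_of_disjoint_iUnion (μ := σ) (As := fun s : ℝ => {s}) 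
    (fun _ => measurableSet_singleton _) (fun _ _ h => by simpa using h) |>.mono
    fun _ hs => pos_iff_ne_zero.mpr hs

end Control

end DiPernaMajda

namespace DiPernaMajda

/-! ### Measurability and integrability of the scaled field along the arc -/

/-- A function of Carathéodory type is jointly measurable off a null set. -/
theorem exists_measurable_uncurry_indicator {α X E : Type*} [MeasurableSpace α] {μ : Measure α}
    [TopologicalSpace X] [TopologicalSpace.MetrizableSpace X] [SecondCountableTopology X] [MeasurableSpace X]
    [OpensMeasurableSpace X]
    [NormedAddCommGroup E] [MeasurableSpace E] [BorelSpace E]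
    {g : α → X → E} {P : α → Prop} (hP : ∀ᵐ t ∂μ, P t) (hc : ∀ t, P t → Continuous (g t))
    (hm : ∀ x, AEMeasurable (fun t => g t x) μ) :
    ∃ G, MeasurableSet G ∧ μ Gᶜ = 0 ∧ (∀ t ∈ G, P t) ∧
      Measurable fun q : α × X => G.indicator (fun t => g t q.2) q.1 := by
  rcases isEmpty_or_nonempty X with hX | hX
  · obtain ⟨N, hPN, hN, hN0⟩ := exists_measurable_superset_of_null hP
    refine ⟨Nᶜ, hN.compl, by rwa [compl_compl], fun t ht => ?_, measurable_of_empty _⟩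
    by_contra h
    exact ht (hPN h)
  -- One null set serves for countably many points; continuity in `x` then gives measurability at
  -- all the others.
  have hall : ∀ᵐ t ∂μ, P t ∧ ∀ i, g t (TopologicalSpace.denseSeq X i)
      = (hm (TopologicalSpace.denseSeq X i)).mk _ t :=
    hP.and (ae_all_iff.mpr fun i => (hm _).ae_eq_mk)
  obtain ⟨N, hPN, hN, hN0⟩ := exists_measurable_superset_of_null hall
  have hG : ∀ t ∈ Nᶜ, P t ∧ ∀ i, g t (TopologicalSpace.denseSeq X i)
      = (hm (TopologicalSpace.denseSeq X i)).mk _ t := fun t ht => by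
    by_contra h
    exact ht (hPN h)
  refine ⟨Nᶜ, hN.compl, by rwa [compl_compl], fun t ht => (hG t ht).1, ?_⟩
  have hcont : ∀ t, Continuous fun x => Nᶜ.indicator (fun t => g t x) t := by
    intro t
    by_cases ht : t ∈ Nᶜ
    · simpa only [indicator_of_mem ht] using hc t (hG t ht).1
    · simpa only [indicator_of_notMem ht] using continuous_const
  have hmeas : ∀ x, Measurable fun t => Nᶜ.indicator (fun t => g t x) t := by
    intro x
    obtain ⟨w, hw, hwx⟩ :=
      mem_closure_iff_seq_limit.mp (TopologicalSpace.denseRange_denseSeq X x)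
    choose i hi using hw
    refine measurable_of_tendsto_metrizable
      (f := fun k t => Nᶜ.indicator (fun t => g t (w k)) t) (fun k => ?_)
      (tendsto_pi_nhds.mpr fun t => ((hcont t).tendsto x).comp hwx)
    have : (fun t => Nᶜ.indicator (fun t => g t (w k)) t)
        = Nᶜ.indicator ((hm (TopologicalSpace.denseSeq X (i k))).mk _) := by
      rw [← hi k]
      exact indicator_congr fun t ht => (hG t ht).2 (i k)
    exact this ▸ (hm _).measurable_mk.indicator hN.compl
  exact (measurable_uncurry_of_continuous_of_measurable hcont hmeas).comp measurable_swap

section Field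

variable {t₀ tf p : ℝ} {n m : ℕ} {Y : Set (Euc n)}
  {c : ℝ → Euc n → Euc m → Euc n} {d : ℝ → Euc m → Euc n} {σ : Measure ℝ} {ν : Kernel ℝ (Gam m)}

/-- The inverse of `toGam` on the open ball. -/
theorem measurable_inv_toGam {m : ℕ} :
    Measurable fun z : Gam m => (1 - ‖(z : Euc m)‖)⁻¹ • (z : Euc m) := by
  fun_prop

/-- The part coming from `d` is bounded. The second growth condition bounds the part coming from `c`
by a multiple of `α₁(t) · weight + |β|`, and the weighted `α₁` is integrable because the weight
turns `σ` back into Lebesgue measure. -/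
theorem integrable_scaledField (hf : DynamicsAssumption t₀ tf p Y c d) (ht : t₀ < tf) (hp : 1 ≤ p)
    (hY : IsCompact Y) {f : ℝ → Euc n → Euc m → Euc n} (hcd : ∀ t y u, f t y u = c t y u + d t u)
    [IsFiniteMeasure σ] [IsMarkovKernel ν] (hσ : IsDiPernaMajda t₀ tf p σ ν)
    {y : ℝ → Euc n} (hy : Measurable y) (hyY : ∀ t ∈ Icc t₀ tf, y t ∈ Y) :
    Integrable (fun q : ℝ × Gam m => scaledField p f q.1 (y q.1) q.2) (σ ⊗ₘ ν) := by
  classical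
  obtain ⟨D, hDm, hDc, ⟨C, hC⟩, hDd⟩ := hf.exists_extension hp
  obtain ⟨ε, β, α₁, α₂, hε, hα₁, -, -, hgrowth, -⟩ := hf.growth
  obtain ⟨R, hR⟩ := hY.isBounded.exists_norm_le
  have hα₁i : Integrable α₁ (volume.restrict (Icc t₀ tf)) := memLp_one_iff_integrable.mp hα₁
  let a := hα₁i.1.aemeasurable.mk
  have ha : Measurable a := hα₁i.1.aemeasurable.measurable_mk
  have haα : α₁ =ᵐ[volume.restrict (Icc t₀ tf)] a := hα₁i.1.aemeasurable.ae_eq_mk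
  obtain ⟨G, hGm, hG0, hGP, hGmeas⟩ := exists_measurable_uncurry_indicator
    (μ := volume.restrict (Icc t₀ tf)) (X := Y × Euc m) (g := fun t q => c t q.1 q.2)
    (P := fun t => Continuous (fun q : Y × Euc m => c t q.1 q.2) ∧ α₁ t = a t)
    (by
      filter_upwards [hf.caratheodory_continuous, haα] with t h1 h2
      exact ⟨h1.comp_continuous (f := fun q : Y × Euc m => ((q.1 : Euc n), q.2)) (by fun_prop)
        fun q => ⟨q.1.2, mem_univ _⟩, h2⟩)
    (fun t h => h.1) (fun q => hf.caratheodory_measurable q.1 q.1.2 q.2)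
  have hy₀ : y t₀ ∈ Y := hyY t₀ ⟨le_rfl, ht.le⟩
  -- Outside `T`, where `σ` has no mass, any point of `Y` will do as a default.
  let yY : ℝ → Y := fun t => if h : t ∈ Icc t₀ tf then ⟨y t, hyY t h⟩ else ⟨y t₀, hy₀⟩
  have hyYv : ∀ t ∈ Icc t₀ tf, (yY t : Euc n) = y t := fun t h => by simp only [yY, dif_pos h]
  have hyYm : Measurable yY := by
    refine Measurable.dite (s := Icc t₀ tf) (f := fun x => (⟨y x, hyY x x.2⟩ : Y)) ?_ measurable_const measurableSet_Icc
    exact (hy.comp measurable_subtype_coe).subtype_mk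
  -- A measurable version of the field. On the sphere at infinity the inverse of `toGam` takes the
  -- junk value `0`, but the weight vanishes there.
  let S : ℝ × Gam m → Euc n := fun q =>
    weight p q.2 • G.indicator (fun t => c t (yY q.1) ((1 - ‖(q.2 : Euc m)‖)⁻¹ • (q.2 : Euc m))) q.1
      + D q.1 q.2
  have hSm : Measurable S := by
    have h1 : Measurable fun q : ℝ × Gam m =>
        (q.1, (yY q.1, (1 - ‖(q.2 : Euc m)‖)⁻¹ • (q.2 : Euc m))) :=
      measurable_fst.prodMk ((hyYm.comp measurable_fst).prodMk
        (measurable_inv_toGam.comp measurable_snd))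
    exact (((continuous_weight hp).measurable.comp measurable_snd).smul (hGmeas.comp h1)).add hDm
  have hae : ∀ᵐ q ∂(σ ⊗ₘ ν), q.1 ∈ Icc t₀ tf ∧ (q.1 ∈ G ∨ ‖(q.2 : Euc m)‖ = 1) := by
    have hms : MeasurableSet {q : ℝ × Gam m | q.1 ∈ Icc t₀ tf ∧ (q.1 ∈ G ∨ ‖(q.2 : Euc m)‖ = 1)} :=
      (measurable_fst measurableSet_Icc).inter ((measurable_fst hGm).union
        ((by fun_prop : Measurable fun q : ℝ × Gam m => ‖(q.2 : Euc m)‖) (measurableSet_singleton 1)))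
    rw [Measure.ae_compProd_iff hms]
    filter_upwards [hσ.ae_mem, hσ.ae_weightMean_eq_zero hp hG0] with t h1 h2
    by_cases h : t ∈ G
    · exact ae_of_all _ fun z => ⟨h1, Or.inl h⟩
    · exact (ae_norm_eq_one_of_weightMean_eq_zero hp (h2 h)).mono fun z hz => ⟨h1, Or.inr hz⟩
  have hSeq : (fun q : ℝ × Gam m => scaledField p f q.1 (y q.1) q.2) =ᵐ[σ ⊗ₘ ν] S := by
    filter_upwards [hae] with ⟨t, z⟩ ⟨h1, h2⟩
    simp only at h1 h2
    by_cases hz : ‖(z : Euc m)‖ = 1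
    · simp only [S, weight_eq_zero_of_norm_eq_one hp hz, zero_smul, zero_add]
      exact hf.scaledField_of_norm_eq_one hp hcd (hDc t) h1 (hDd t h1) (hyY t h1) hz
    · obtain ⟨u, rfl⟩ := exists_toGam_eq hz
      have htG := h2.resolve_right hz
      have hcc : Continuous (c t (y t)) :=
        (hGP t htG).1.comp (by fun_prop : Continuous fun u => ((⟨y t, hyY t h1⟩ : Y), u))
      simp only [S, inv_toGam, weight_toGam hp, indicator_of_mem htG, hyYv t h1]
      rw [scaledField_toGam hp hcd (hDc t) (hDd t h1) hcc, one_div]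
  have hbound : ∀ᵐ q ∂(σ ⊗ₘ ν), ‖scaledField p f q.1 (y q.1) q.2‖
      ≤ (|a q.1| * weight p q.2 + |β|) * (1 + R) + C := by
    filter_upwards [hae, hSeq] with ⟨t, z⟩ ⟨h1, h2⟩ h3
    simp only at h1 h2 h3 ⊢
    have hR0 : ‖y t‖ ≤ R := hR _ (hyY t h1)
    have hR1 : 0 ≤ R := (norm_nonneg _).trans hR0
    have hw := weight_mem_Icc hp z
    rw [h3]
    refine (norm_add_le _ _).trans (add_le_add ?_ (hC _ _))
    by_cases hz : ‖(z : Euc m)‖ = 1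
    · simp only [weight_eq_zero_of_norm_eq_one hp hz, zero_smul, norm_zero, mul_zero, zero_add]
      positivity
    · obtain ⟨u, rfl⟩ := exists_toGam_eq hz
      have htG := h2.resolve_right hz
      simp only [inv_toGam, indicator_of_mem htG, hyYv t h1]
      rw [norm_smul, Real.norm_of_nonneg hw.1]
      have hg := hgrowth t h1 (y t) (hyY t h1) u
      rw [(hGP t htG).2] at hg
      have hup : 0 ≤ ‖u‖ ^ p := Real.rpow_nonneg (norm_nonneg u) p
      have hwu : weight p (toGam u) * ‖u‖ ^ p ≤ 1 := by
        rw [weight_toGam hp, one_div_mul_eq_div, div_le_one (one_add_norm_rpow_pos p u)]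
        linarith
      calc weight p (toGam u) * ‖c t (y t) u‖
          ≤ weight p (toGam u) * ((|a t| + |β| * ‖u‖ ^ p) * (1 + R)) := by
            refine mul_le_mul_of_nonneg_left (hg.trans ?_) hw.1
            refine mul_le_mul (add_le_add (le_abs_self _) ?_) (by linarith) (by positivity)
              (by positivity)
            exact mul_le_mul_of_nonneg_right (le_abs_self β) hup
        _ = (|a t| * weight p (toGam u) + |β| * (weight p (toGam u) * ‖u‖ ^ p)) * (1 + R) := by
            ring
        _ ≤ _ := by
            refine mul_le_mul_of_nonneg_right ?_ (by positivity)
            nlinarith [abs_nonneg β]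
  -- Integrating out `u` leaves `|a| · weightMean`, which is `σ`-integrable since `a` is integrable
  -- on `T`.
  have hint : Integrable (fun q : ℝ × Gam m => |a q.1| * weight p q.2) (σ ⊗ₘ ν) := by
    have hms : Measurable fun q : ℝ × Gam m => |a q.1| * weight p q.2 :=
      (ha.comp measurable_fst).abs.mul ((continuous_weight hp).measurable.comp measurable_snd)
    rw [Measure.integrable_compProd_iff hms.aestronglyMeasurable]
    refine ⟨ae_of_all _ fun t => (integrable_weight hp (ν t)).const_mul |a t|, ?_⟩
    refine (hσ.integrable_weightMean_mul hp (hα₁i.congr haα).abs).congr (ae_of_all _ fun t => ?_)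
    simp only [norm_mul, Real.norm_eq_abs, abs_abs, abs_of_nonneg (weight_mem_Icc hp _).1]
    rw [integral_const_mul, mul_comm]
    rfl
  exact Integrable.mono' (((hint.add (integrable_const _)).mul_const _).add (integrable_const _))
    (hSm.aestronglyMeasurable.congr hSeq.symm) hbound

end Field

end DiPernaMajda

namespace DiPernaMajda

/-! ### A chain rule for right-continuous functions of bounded variation -/

theorem tendsto_setIntegral_of_eventually_mem_iff {α ι E : Type*} [MeasurableSpace α]
    {μ : Measure α} [NormedAddCommGroup E] [NormedSpace ℝ E] {l : Filter ι}
    [l.IsCountablyGenerated] {A : ι → Set α} {B : Set α} (hA : ∀ i, MeasurableSet (A i))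
    (hB : MeasurableSet B) (h : ∀ x, ∀ᶠ i in l, (x ∈ A i ↔ x ∈ B)) {f : α → E}
    (hf : Integrable f μ) :
    Tendsto (fun i => ∫ x in A i, f x ∂μ) l (𝓝 (∫ x in B, f x ∂μ)) := by
  simp only [← integral_indicator (hA _), ← integral_indicator hB]
  refine tendsto_integral_filter_of_dominated_convergence (fun x => ‖f x‖)
    (Eventually.of_forall fun i => hf.1.indicator (hA i))
    (Eventually.of_forall fun i => ae_of_all _ fun x => norm_indicator_le_norm_self _ _) hf.norm
    (ae_of_all _ fun x => ?_)
  refine tendsto_const_nhds.congr' ?_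
  filter_upwards [h x] with i hi
  by_cases hx : x ∈ B
  · rw [indicator_of_mem hx, indicator_of_mem (hi.mpr hx)]
  · rw [indicator_of_notMem hx, indicator_of_notMem fun hx' => hx (hi.mp hx')]

/-- An atom at `t` is missed when `t` is approached strictly from the left, hence `Ioo` in the
limit; it is retained from the right, as in `tendsto_setIntegral_Ioc_nhdsGE`. -/
theorem tendsto_setIntegral_Ioc_nhdsLT {E : Type*} [NormedAddCommGroup E] [NormedSpace ℝ E]
    {σ : Measure ℝ} {Φ : ℝ → E} (hΦ : Integrable Φ σ) (a t : ℝ) :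
    Tendsto (fun s => ∫ x in Ioc a s, Φ x ∂σ) (𝓝[<] t) (𝓝 (∫ x in Ioo a t, Φ x ∂σ)) := by
  refine tendsto_setIntegral_of_eventually_mem_iff (fun _ => measurableSet_Ioc) measurableSet_Ioo
    (fun x => ?_) hΦ
  rcases lt_or_ge x t with hx | hx
  · filter_upwards [nhdsWithin_le_nhds (lt_mem_nhds hx)] with s hs
    simp [hx, hs.le]
  · filter_upwards [self_mem_nhdsWithin] with s hs
    simp [not_lt.mpr hx, not_le.mpr (lt_of_lt_of_le hs hx)]

theorem tendsto_setIntegral_Ioc_nhdsGE {E : Type*} [NormedAddCommGroup E] [NormedSpace ℝ E]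
    {σ : Measure ℝ} {Φ : ℝ → E} (hΦ : Integrable Φ σ) (a t : ℝ) :
    Tendsto (fun s => ∫ x in Ioc a s, Φ x ∂σ) (𝓝[≥] t) (𝓝 (∫ x in Ioc a t, Φ x ∂σ)) := by
  refine tendsto_setIntegral_of_eventually_mem_iff (fun _ => measurableSet_Ioc) measurableSet_Ioc
    (fun x => ?_) hΦ
  rcases le_or_gt x t with hx | hx
  · filter_upwards [self_mem_nhdsWithin] with s hs
    simp [hx, hx.trans hs]
  · filter_upwards [nhdsWithin_le_nhds (gt_mem_nhds hx)] with s hs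
    simp [not_le.mpr hx, not_le.mpr hs]

section ChainRule

variable {E : Type*} [NormedAddCommGroup E] [NormedSpace ℝ E]

/-- The mean of the derivative of `V` on the segment from `x` to `x'`. -/
noncomputable def meanDeriv (V : E → ℝ) (x x' : E) : E →L[ℝ] ℝ :=
  ∫ r in (0 : ℝ)..1, fderiv ℝ V (x + r • (x' - x))

variable {V : E → ℝ}

theorem continuous_fderiv_segment (hV : ContDiff ℝ 1 V) (x x' : E) :
    Continuous fun r : ℝ => fderiv ℝ V (x + r • (x' - x)) :=
  (hV.continuous_fderiv one_ne_zero).comp (by fun_prop)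

theorem meanDeriv_apply (hV : ContDiff ℝ 1 V) (x x' w : E) :
    meanDeriv V x x' w = ∫ r in (0 : ℝ)..1, fderiv ℝ V (x + r • (x' - x)) w :=
  ContinuousLinearMap.intervalIntegral_apply
    ((continuous_fderiv_segment hV x x').intervalIntegrable 0 1) w

theorem meanDeriv_apply_sub (hV : ContDiff ℝ 1 V) (x x' : E) :
    meanDeriv V x x' (x' - x) = V x' - V x := by
  rw [meanDeriv_apply hV]
  have h : ∀ r ∈ uIcc (0 : ℝ) 1, HasDerivAt (fun r : ℝ => V (x + r • (x' - x)))
      (fderiv ℝ V (x + r • (x' - x)) (x' - x)) r := fun r _ => by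
    have h1 : HasDerivAt (fun r : ℝ => x + r • (x' - x)) (x' - x) r := by
      simpa using ((hasDerivAt_id r).smul_const (x' - x)).const_add x
    exact ((hV.differentiable one_ne_zero _).hasFDerivAt).comp_hasDerivAt r h1
  rw [intervalIntegral.integral_eq_sub_of_hasDerivAt h
    (((continuous_fderiv_segment hV x x').clm_apply continuous_const).intervalIntegrable 0 1)]
  simp

theorem continuous_meanDeriv (hV : ContDiff ℝ 1 V) :
    Continuous fun q : E × E => meanDeriv V q.1 q.2 := by
  refine intervalIntegral.continuous_parametric_intervalIntegral_of_continuous'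
    (f := fun (q : E × E) r => fderiv ℝ V (q.1 + r • (q.2 - q.1))) ?_ 0 1
  exact (hV.continuous_fderiv one_ne_zero).comp (by fun_prop)

theorem norm_meanDeriv_le {C : ℝ} (hC : ∀ x, ‖fderiv ℝ V x‖ ≤ C) (x x' : E) :
    ‖meanDeriv V x x'‖ ≤ C := by
  simpa [meanDeriv] using intervalIntegral.norm_integral_le_of_norm_le_const
    (f := fun r : ℝ => fderiv ℝ V (x + r • (x' - x))) (a := 0) (b := 1) fun r _ => hC _

variable [CompleteSpace E] {σ : Measure ℝ} {Φ : ℝ → E}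

/-- The increment of `V` along the primitive `x₀ + ∫_{(a, t]} Φ dσ`: at atoms of `σ`, the derivative
of `V` is averaged over the segment joining the one-sided limits. -/
theorem sub_eq_setIntegral_meanDeriv (hΦ : Integrable Φ σ) (hV : ContDiff ℝ 1 V) {C : ℝ}
    (hC : ∀ x, ‖fderiv ℝ V x‖ ≤ C) {a b : ℝ} (hab : a < b) (x₀ : E) :
    V (x₀ + ∫ t in Ioc a b, Φ t ∂σ) - V x₀ =
      ∫ t in Ioc a b, meanDeriv V (x₀ + ∫ s in Ioo a t, Φ s ∂σ) (x₀ + ∫ s in Ioc a t, Φ s ∂σ) (Φ t)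
        ∂σ := by
  let P : ℝ → E := fun t => x₀ + ∫ s in Ioc a t, Φ s ∂σ
  -- With this mesh, `k + 1` steps lead from `a` exactly to `b`.
  let h : ℕ → ℝ := fun k => (b - a) / (k + 1)
  have hpos : ∀ k, 0 < h k := fun k => div_pos (sub_pos.mpr hab) (by positivity)
  have hlim : Tendsto h atTop (𝓝 0) :=
    (tendsto_atTop_add_const_right _ 1 tendsto_natCast_atTop_atTop).const_div_atTop _
  -- The ceiling of `(t - a) / h k` is the index `j` of the cell `(a + (j - 1) h, a + j h]`
  -- containing `t`; on that cell `G k` applies one fixed linear form to `Φ`.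
  let H : ℕ → ℤ → E →L[ℝ] ℝ := fun k j => meanDeriv V (P (a + (j - 1) * h k)) (P (a + j * h k))
  let G : ℕ → ℝ → ℝ := fun k t => H k ⌈(t - a) / h k⌉ (Φ t)
  have hGm : ∀ k, AEStronglyMeasurable (G k) σ := fun k => by
    have h1 : StronglyMeasurable fun t => H k ⌈(t - a) / h k⌉ :=
      (StronglyMeasurable.of_discrete (f := H k)).comp_measurable
        (Int.measurable_ceil.comp (by fun_prop))
    exact isBoundedBilinearMap_apply.continuous.comp_aestronglyMeasurable
      (h1.aestronglyMeasurable.prodMk hΦ.1)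
  have hGb : ∀ k t, ‖G k t‖ ≤ C * ‖Φ t‖ := fun k t =>
    (ContinuousLinearMap.le_opNorm _ _).trans
      (mul_le_mul_of_nonneg_right (norm_meanDeriv_le hC _ _) (norm_nonneg _))
  have hGi : ∀ k, Integrable (G k) σ := fun k =>
    (hΦ.norm.const_mul C).mono' (hGm k) (ae_of_all _ (hGb k))
  -- The mean derivative makes each cell contribute exactly the increment of `V ∘ P`, so the sum
  -- telescopes with no error term, for every `k`.
  have hstep : ∀ k, ∫ t in Ioc a b, G k t ∂σ = V (P b) - V x₀ := by
    intro k
    let τ : ℕ → ℝ := fun i => a + i * h k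
    have hτ0 : τ 0 = a := by simp [τ]
    have hτn : τ (k + 1) = b := by
      simp only [τ, h]; push_cast; field_simp; ring
    have hτlt : ∀ i, τ i < τ (i + 1) := fun i => by
      have := hpos k
      simp only [τ]; push_cast; linarith
    have hτa : ∀ i, a ≤ τ i := fun i => by
      have := hpos k
      simp only [τ]; nlinarith [(Nat.cast_nonneg i : (0 : ℝ) ≤ i)]
    have hinc : ∀ i, ∫ t in τ i..τ (i + 1), G k t ∂σ = V (P (τ (i + 1))) - V (P (τ i)) := by
      intro i
      have hcongr : ∫ t in τ i..τ (i + 1), G k t ∂σ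
          = ∫ t in τ i..τ (i + 1), meanDeriv V (P (τ i)) (P (τ (i + 1))) (Φ t) ∂σ := by
        rw [intervalIntegral.integral_of_le (hτlt i).le,
          intervalIntegral.integral_of_le (hτlt i).le]
        refine setIntegral_congr_fun measurableSet_Ioc fun t ht => ?_
        have hceil : ⌈(t - a) / h k⌉ = (i : ℤ) + 1 := by
          have hk := hpos k
          rw [Int.ceil_eq_iff]
          have h1 := ht.1
          have h2 := ht.2
          simp only [τ] at h1 h2
          push_cast at h2 ⊢
          rw [lt_div_iff₀ hk, div_le_iff₀ hk]
          constructor <;> linarith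
        simp only [G, H, hceil, τ]
        push_cast
        rw [add_sub_cancel_right]
      have hP : P (τ (i + 1)) - P (τ i) = ∫ t in τ i..τ (i + 1), Φ t ∂σ := by
        simp only [P]
        rw [add_sub_add_left_eq_sub, ← intervalIntegral.integral_of_le (hτa _),
          ← intervalIntegral.integral_of_le (hτa _)]
        exact intervalIntegral.integral_interval_sub_left hΦ.intervalIntegrable
          hΦ.intervalIntegrable
      rw [hcongr, ContinuousLinearMap.intervalIntegral_comp_comm _ hΦ.intervalIntegrable, ← hP,
        meanDeriv_apply_sub hV]
    rw [← intervalIntegral.integral_of_le hab.le]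
    conv_lhs => rw [← hτ0, ← hτn]
    rw [← intervalIntegral.sum_integral_adjacent_intervals
      fun i _ => (hGi k).intervalIntegrable, Finset.sum_congr rfl fun i _ => hinc i,
      Finset.sum_range_sub (fun i => V (P (τ i))), hτn, hτ0]
    simp [P]
  have hconv : Tendsto (fun k => ∫ t in Ioc a b, G k t ∂σ) atTop
      (𝓝 (∫ t in Ioc a b, meanDeriv V (x₀ + ∫ s in Ioo a t, Φ s ∂σ) (P t) (Φ t) ∂σ)) := by
    refine tendsto_integral_of_dominated_convergence (fun t => C * ‖Φ t‖)
      (fun k => (hGm k).restrict) (hΦ.norm.const_mul C).restrict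
      (fun k => ae_of_all _ (hGb k)) (ae_of_all _ fun t => ?_)
    -- The left end of the cell is strictly below `t` and the right end is at or above it, so `P`
    -- converges along them to its left limit and to its value at `t`: this is where the segment
    -- across an atom appears.
    have hl : Tendsto (fun k => a + (⌈(t - a) / h k⌉ - 1) * h k) atTop (𝓝[<] t) := by
      refine tendsto_nhdsWithin_iff.mpr ⟨?_, Eventually.of_forall fun k => ?_⟩
      · have h0 : Tendsto (fun k => t - h k) atTop (𝓝 t) := by simpa using hlim.const_sub t
        refine tendsto_of_tendsto_of_tendsto_of_le_of_le h0 tendsto_const_nhds (fun k => ?_)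
          fun k => ?_
        · have h1 := Int.le_ceil ((t - a) / h k)
          rw [div_le_iff₀ (hpos k)] at h1
          simp only; nlinarith
        · have h1 := Int.ceil_lt_add_one ((t - a) / h k)
          rw [← sub_lt_iff_lt_add, lt_div_iff₀ (hpos k)] at h1
          simp only; linarith
      · have h1 := Int.ceil_lt_add_one ((t - a) / h k)
        rw [← sub_lt_iff_lt_add, lt_div_iff₀ (hpos k)] at h1
        simp only [mem_Iio]; linarith
    have hr : Tendsto (fun k => a + ⌈(t - a) / h k⌉ * h k) atTop (𝓝[≥] t) := by
      refine tendsto_nhdsWithin_iff.mpr ⟨?_, Eventually.of_forall fun k => ?_⟩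
      · have h0 := (tendsto_nhds_of_tendsto_nhdsWithin hl).add hlim
        rw [add_zero] at h0
        refine h0.congr fun k => by ring
      · have h1 := Int.le_ceil ((t - a) / h k)
        rw [div_le_iff₀ (hpos k)] at h1
        simp only [mem_Ici]; linarith
    have h1 := ((tendsto_setIntegral_Ioc_nhdsLT hΦ a t).const_add x₀).comp hl
    have h2 := ((tendsto_setIntegral_Ioc_nhdsGE hΦ a t).const_add x₀).comp hr
    have h3 := ((continuous_meanDeriv hV).tendsto _).comp (h1.prodMk_nhds h2)
    exact ((ContinuousLinearMap.apply ℝ ℝ (Φ t)).continuous.tendsto _).comp h3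
  simp only [hstep] at hconv
  exact tendsto_nhds_unique tendsto_const_nhds hconv

end ChainRule

end DiPernaMajda

namespace DiPernaMajda

/-! ### Functions of bounded variation -/

theorem exists_monotone_sub_monotone_coord {n : ℕ} {y : ℝ → Euc n} (hy : BoundedVariationOn y univ)
    (i : Fin n) : ∃ p q : ℝ → ℝ, Monotone p ∧ Monotone q ∧ (fun t => y t i) = p - q := by
  have h1 : BoundedVariationOn (EuclideanSpace.proj (𝕜 := ℝ) i ∘ y) univ :=
    (EuclideanSpace.proj (𝕜 := ℝ) i).lipschitz.comp_boundedVariationOn hy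
  obtain ⟨p, q, hp, hq, h⟩ := h1.locallyBoundedVariationOn.exists_monotoneOn_sub_monotoneOn
  exact ⟨p, q, monotoneOn_univ.mp hp, monotoneOn_univ.mp hq, h⟩

theorem measurable_of_boundedVariationOn {n : ℕ} {y : ℝ → Euc n}
    (hy : BoundedVariationOn y univ) : Measurable y := by
  have h : Measurable fun t i => y t i := measurable_pi_lambda _ fun i => by
    obtain ⟨p, q, hp, hq, h⟩ := exists_monotone_sub_monotone_coord hy i
    rw [h]
    exact hp.measurable.sub hq.measurable
  exact (WithLp.measurable_toLp 2 _).comp h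

theorem countable_not_continuousAt_of_boundedVariationOn {n : ℕ} {y : ℝ → Euc n}
    (hy : BoundedVariationOn y univ) : {t | ¬ContinuousAt y t}.Countable := by
  choose p q hp hq h using exists_monotone_sub_monotone_coord hy
  refine (countable_iUnion fun i => (hp i).countable_not_continuousAt.union
    (hq i).countable_not_continuousAt).mono fun t ht => ?_
  by_contra hn
  simp only [mem_iUnion, mem_union, mem_ofPred_eq, not_exists, not_or, not_not] at hn
  refine ht ?_
  have h1 : ContinuousAt (fun t i => y t i) t := continuousAt_pi.mpr fun i => by
    rw [h i]
    exact (hn i).1.sub (hn i).2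
  exact (PiLp.continuous_toLp 2 _).continuousAt.comp h1

/-! ### The jumps of a relaxed arc -/

/-- The mean of the scaled field under `ν(· | t)` along the arc. -/
noncomputable def meanField (p : ℝ) {n m : ℕ} (f : ℝ → Euc n → Euc m → Euc n)
    (ν : Kernel ℝ (Gam m)) (y : ℝ → Euc n) (t : ℝ) : Euc n :=
  ∫ z, scaledField p f t (y t) z ∂(ν t)

section Arc

variable {t₀ tf p : ℝ} {n m : ℕ} {Y : Set (Euc n)}
  {c : ℝ → Euc n → Euc m → Euc n} {d : ℝ → Euc m → Euc n} {f : ℝ → Euc n → Euc m → Euc n}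
  {y₀ yf : Euc n} {σ : Measure ℝ} {ν : Kernel ℝ (Gam m)} {y : ℝ → Euc n} {ys : ℝ → ℝ → Euc n}

namespace IsRelaxedArc

theorem measurable_state (harc : IsRelaxedArc t₀ tf p Y f y₀ yf σ ν y ys) :
    Measurable y := measurable_of_boundedVariationOn harc.state.bv

/-- `σ` is carried by `T`. Starting the half-open interval at `t₀ - 1` lets primitives include a
possible atom at `t₀`. -/
theorem setIntegral_Ioc_eq_Icc (harc : IsRelaxedArc t₀ tf p Y f y₀ yf σ ν y ys)
    {E : Type*} [NormedAddCommGroup E] [NormedSpace ℝ E] {Φ : ℝ → E}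
    (τ : ℝ) : ∫ t in Ioc (t₀ - 1) τ, Φ t ∂σ = ∫ t in Icc t₀ τ, Φ t ∂σ := by
  refine setIntegral_congr_set ?_
  filter_upwards [harc.control.ae_mem] with t ht
  refine propext ⟨fun h => ⟨ht.1, h.2⟩, fun h => ⟨?_, h.2⟩⟩
  linarith [ht.1]

/-- A function of bounded variation has countably many discontinuities, and a countable set of
points that are not atoms is null. -/
theorem ae_continuousAt (harc : IsRelaxedArc t₀ tf p Y f y₀ yf σ ν y ys) :
    ∀ᵐ t ∂σ, t ∉ atoms σ → ContinuousAt y t := by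
  have hc : ({t | ¬ContinuousAt y t} ∩ (atoms σ)ᶜ).Countable :=
    (countable_not_continuousAt_of_boundedVariationOn harc.state.bv).mono inter_subset_left
  have h0 : σ ({t | ¬ContinuousAt y t} ∩ (atoms σ)ᶜ) = 0 := by
    rw [← biUnion_of_singleton ({t | ¬ContinuousAt y t} ∩ (atoms σ)ᶜ),
      measure_biUnion_null_iff hc]
    exact fun s hs => not_not.mp hs.2
  filter_upwards [measure_eq_zero_iff_ae_notMem.mp h0] with t h1 h2
  by_contra h3
  exact h1 ⟨h3, h2⟩

end IsRelaxedArc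

variable [IsFiniteMeasure σ] [IsMarkovKernel ν]

theorem IsDiPernaMajda.ae_scaledField_eq (hσ : IsDiPernaMajda t₀ tf p σ ν)
    (hf : DynamicsAssumption t₀ tf p Y c d) (hp : 1 ≤ p)
    (hcd : ∀ t y u, f t y u = c t y u + d t u) {s : ℝ} (hs : s ∈ atoms σ) {y₁ y₂ : Euc n}
    (hy₁ : y₁ ∈ Y) (hy₂ : y₂ ∈ Y) :
    ∀ᵐ z ∂(ν s), scaledField p f s y₁ z = scaledField p f s y₂ z := by
  obtain ⟨D, -, hDc, -, hDd⟩ := hf.exists_extension hp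
  have hsT := hσ.atoms_subset hs
  filter_upwards [ae_norm_eq_one_of_weightMean_eq_zero hp
    (hσ.weightMean_eq_zero_of_mem_atoms hp hs)] with z hz
  rw [hf.scaledField_of_norm_eq_one hp hcd (hDc s) hsT (hDd s hsT) hy₁ hz,
    hf.scaledField_of_norm_eq_one hp hcd (hDc s) hsT (hDd s hsT) hy₂ hz]

theorem measureReal_singleton_pos_of_mem_atoms {s : ℝ} (hs : s ∈ atoms σ) : 0 < σ.real {s} :=
  ENNReal.toReal_pos hs (measure_ne_top σ _)

namespace IsRelaxedArc

variable (harc : IsRelaxedArc t₀ tf p Y f y₀ yf σ ν y ys)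
include harc

/-- The fictitious state runs along a segment with constant velocity. -/
theorem fictitious_state_eq (hf : DynamicsAssumption t₀ tf p Y c d) (hp : 1 ≤ p)
    (hcd : ∀ t y u, f t y u = c t y u + d t u) {s : ℝ} (hs : s ∈ atoms σ) :
    ∀ r ∈ Icc 0 (σ.real {s}), ys s r = Function.leftLim y s + r • meanField p f ν y s := by
  have hsT := harc.control.atoms_subset hs
  have hder : ∀ r ∈ Icc 0 (σ.real {s}),
      HasDerivWithinAt (ys s) (meanField p f ν y s) (Icc 0 (σ.real {s})) r := fun r hr => by
    have h1 := harc.solution.jump_ode s hs r hr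
    rwa [integral_congr_ae (harc.control.ae_scaledField_eq hf hp hcd hs
      (harc.solution.jump_mem s hs r hr) (harc.state.mem s hsT))] at h1
  have hder2 : ∀ r ∈ Icc 0 (σ.real {s}), HasDerivWithinAt
      (fun r => ys s r - r • meanField p f ν y s) 0 (Icc 0 (σ.real {s})) r := fun r hr => by
    have h1 := (hder r hr).sub ((hasDerivWithinAt_id r _).smul_const (meanField p f ν y s))
    rw [one_smul, sub_self] at h1
    exact h1
  intro r hr
  -- The velocity no longer depends on `r`, so subtracting the linear motion leaves a function with
  -- zero derivative.
  have h1 := constant_of_has_deriv_right_zero (fun r hr => (hder2 r hr).continuousWithinAt)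
    (fun r hr => (hder2 r (Ico_subset_Icc_self hr)).mono_of_mem_nhdsWithin
      (Icc_mem_nhdsGE_of_mem hr)) r hr
  simp only [zero_smul, sub_zero, harc.solution.jump_start s hs] at h1
  rw [← h1, sub_add_cancel]

theorem rightLim_sub_leftLim (hf : DynamicsAssumption t₀ tf p Y c d) (hp : 1 ≤ p)
    (hcd : ∀ t y u, f t y u = c t y u + d t u) {s : ℝ} (hs : s ∈ atoms σ) :
    Function.rightLim y s - Function.leftLim y s = σ.real {s} • meanField p f ν y s := by
  rw [← harc.solution.jump_end s hs, harc.fictitious_state_eq hf hp hcd hs _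
    ⟨(measureReal_singleton_pos_of_mem_atoms hs).le, le_rfl⟩, add_sub_cancel_left]

theorem integrable_scaledField (hf : DynamicsAssumption t₀ tf p Y c d) (ht : t₀ < tf) (hp : 1 ≤ p)
    (hY : IsCompact Y) (hcd : ∀ t y u, f t y u = c t y u + d t u) :
    Integrable (fun q : ℝ × Gam m => scaledField p f q.1 (y q.1) q.2) (σ ⊗ₘ ν) :=
  DiPernaMajda.integrable_scaledField hf ht hp hY hcd harc.control harc.measurable_state
    harc.state.mem

theorem integrable_meanField (hf : DynamicsAssumption t₀ tf p Y c d) (ht : t₀ < tf) (hp : 1 ≤ p)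
    (hY : IsCompact Y) (hcd : ∀ t y u, f t y u = c t y u + d t u) :
    Integrable (meanField p f ν y) σ :=
  (harc.integrable_scaledField hf ht hp hY hcd).integral_compProd

/-- The right limits of the arc are a primitive of the mean field with respect to `σ`. -/
theorem rightLim_eq (hf : DynamicsAssumption t₀ tf p Y c d) (ht : t₀ < tf) (hp : 1 ≤ p)
    (hY : IsCompact Y) (hcd : ∀ t y u, f t y u = c t y u + d t u) {τ : ℝ} (hτ : τ ∈ Icc t₀ tf) :
    Function.rightLim y τ
      = Function.leftLim y t₀ + ∫ t in Ioc (t₀ - 1) τ, meanField p f ν y t ∂σ := by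
  have hF := harc.integrable_meanField hf ht hp hY hcd
  have hc : (atoms σ ∩ Icc t₀ τ).Countable := countable_atoms.mono inter_subset_left
  have hJ : MeasurableSet (atoms σ) := countable_atoms.measurableSet
  -- Each jump is the mean field times the mass of the atom, so the sum is the part of the
  -- `σ`-integral carried by the countable set of atoms.
  have hsum : ∑' s : (atoms σ ∩ Icc t₀ τ : Set ℝ), (Function.rightLim y s - Function.leftLim y s)
      = ∫ t in atoms σ ∩ Icc t₀ τ, meanField p f ν y t ∂σ := by
    rw [setIntegral_countable _ hc hF.integrableOn]
    exact tsum_congr fun s => harc.rightLim_sub_leftLim hf hp hcd s.2.1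
  rw [harc.solution.integral_eq τ hτ, hsum, harc.setIntegral_Ioc_eq_Icc, contPart,
    Measure.restrict_restrict measurableSet_Icc, add_assoc]
  congr 1
  have h1 := integral_inter_add_sdiff (s := Icc t₀ τ) hJ hF.integrableOn
  rw [inter_comm, sdiff_eq, add_comm] at h1
  exact h1

theorem leftLim_eq (hf : DynamicsAssumption t₀ tf p Y c d) (ht : t₀ < tf) (hp : 1 ≤ p)
    (hY : IsCompact Y) (hcd : ∀ t y u, f t y u = c t y u + d t u) {τ : ℝ} (hτ : τ ∈ Icc t₀ tf) :
    Function.leftLim y τ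
      = Function.leftLim y t₀ + ∫ t in Ioo (t₀ - 1) τ, meanField p f ν y t ∂σ := by
  have hF := harc.integrable_meanField hf ht hp hY hcd
  rcases hτ.1.eq_or_lt with h | h
  · subst h
    have h0 : σ (Ioo (t₀ - 1) t₀) = 0 :=
      measure_mono_null (fun _ ht => fun ht' => not_lt.mpr ht'.1 ht.2) harc.control.supported
    rw [setIntegral_measure_zero _ h0, add_zero]
  -- The left limit of `y` is also that of its right limits, for which `rightLim_eq` provides a
  -- formula.
  · have h1 := harc.state.bv.rightLim.tendsto_leftLim τ
    rw [leftLim_rightLim (harc.state.bv.tendsto_leftLim τ)] at h1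
    have h2 := (tendsto_setIntegral_Ioc_nhdsLT hF (t₀ - 1) τ).const_add (Function.leftLim y t₀)
    refine tendsto_nhds_unique h1 (h2.congr' ?_)
    filter_upwards [Ioo_mem_nhdsLT h] with s hs
    exact (harc.rightLim_eq hf ht hp hY hcd ⟨hs.1.le, hs.2.le.trans hτ.2⟩).symm

theorem leftLim_eq_rightLim (hf : DynamicsAssumption t₀ tf p Y c d) (ht : t₀ < tf) (hp : 1 ≤ p)
    (hY : IsCompact Y) (hcd : ∀ t y u, f t y u = c t y u + d t u) {τ : ℝ} (hτ : τ ∈ Icc t₀ tf)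
    (hτJ : τ ∉ atoms σ) : Function.leftLim y τ = Function.rightLim y τ := by
  rw [harc.leftLim_eq hf ht hp hY hcd hτ, harc.rightLim_eq hf ht hp hY hcd hτ]
  congr 1
  refine setIntegral_congr_set ?_
  have h0 : ∀ᵐ t ∂σ, t ∉ ({τ} : Set ℝ) := measure_eq_zero_iff_ae_notMem.mp (not_not.mp hτJ)
  filter_upwards [h0] with t h1
  exact propext ⟨fun h => ⟨h.1, h.2.le⟩, fun h => ⟨h.1, lt_of_le_of_ne h.2 h1⟩⟩

/-- Needed at the two ends of `T`, since the localized test function agrees with `v` only near `T ×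
Y`. -/
theorem leftLim_rightLim_mem (hf : DynamicsAssumption t₀ tf p Y c d) (ht : t₀ < tf) (hp : 1 ≤ p)
    (hY : IsCompact Y) (hcd : ∀ t y u, f t y u = c t y u + d t u) {τ : ℝ} (hτ : τ ∈ Icc t₀ tf) :
    Function.leftLim y τ ∈ Y ∧ Function.rightLim y τ ∈ Y := by
  by_cases hτJ : τ ∈ atoms σ
  · have hpos := measureReal_singleton_pos_of_mem_atoms hτJ
    rw [← harc.solution.jump_start τ hτJ, ← harc.solution.jump_end τ hτJ]
    exact ⟨harc.solution.jump_mem τ hτJ _ ⟨le_rfl, hpos.le⟩,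
      harc.solution.jump_mem τ hτJ _ ⟨hpos.le, le_rfl⟩⟩
  · rw [harc.leftLim_eq_rightLim hf ht hp hY hcd hτ hτJ, and_self]
    -- At `tf` the right limit is approached through times outside `T`, where `y` is not assumed to
    -- lie in `Y`; the left limit replaces it.
    rcases hτ.2.eq_or_lt with h | h
    · rw [← harc.leftLim_eq_rightLim hf ht hp hY hcd hτ hτJ]
      refine hY.isClosed.mem_of_tendsto (harc.state.bv.tendsto_leftLim τ) ?_
      filter_upwards [Ioo_mem_nhdsLT (h ▸ ht : t₀ < τ)] with s hs
      exact harc.state.mem s ⟨hs.1.le, hs.2.le.trans hτ.2⟩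
    · refine hY.isClosed.mem_of_tendsto (harc.state.bv.tendsto_rightLim τ) ?_
      filter_upwards [Ioo_mem_nhdsGT h] with s hs
      exact harc.state.mem s ⟨hτ.1.trans hs.1.le, hs.2.le⟩

end IsRelaxedArc

end Arc

end DiPernaMajda

namespace DiPernaMajda

/-! ### Localization of the test function -/

/-- A `C¹` function on a neighbourhood of a compact set coincides near this set with a `C¹` function
of compact support. -/
theorem exists_contDiff_hasCompactSupport_eventuallyEq {E : Type*} [NormedAddCommGroup E]
    [NormedSpace ℝ E] [FiniteDimensional ℝ E] {K U : Set E} (hK : IsCompact K) (hU : IsOpen U)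
    (hKU : K ⊆ U) {v : E → ℝ} (hv : ContDiffOn ℝ 1 v U) :
    ∃ V : E → ℝ, ContDiff ℝ 1 V ∧ HasCompactSupport V ∧ ∀ x ∈ K, V =ᶠ[𝓝 x] v := by
  obtain ⟨K', hK', hKK', hK'U⟩ := exists_compact_between hK hU hKU
  obtain ⟨χ, hχ1, hχ0, -⟩ := exists_contMDiffMap_one_nhds_of_subset_interior (n := 1)
    (modelWithCornersSelf ℝ E) hK.isClosed hKK'
  have hχ : ContDiff ℝ 1 χ := χ.contMDiff.contDiff
  refine ⟨fun x => χ x * v x, contDiff_iff_contDiffAt.mpr fun x => ?_,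
    HasCompactSupport.intro hK' fun x hx => by rw [hχ0 x hx, zero_mul], fun x hx => ?_⟩
  · by_cases hx : x ∈ U
    · exact hχ.contDiffAt.mul (hv.contDiffAt (hU.mem_nhds hx))
    · refine (contDiffAt_const (c := (0 : ℝ))).congr_of_eventuallyEq ?_
      filter_upwards [hK'.isClosed.isOpen_compl.mem_nhds fun h => hx (hK'U h)] with w hw
      rw [hχ0 w hw, zero_mul]
  · filter_upwards [(eventually_nhdsSet_iff_forall.mp hχ1) x hx] with w hw
    rw [hw, one_mul]

theorem exists_norm_fderiv_le {E : Type*} [NormedAddCommGroup E] [NormedSpace ℝ E] {V : E → ℝ}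
    (hV : ContDiff ℝ 1 V) (hVc : HasCompactSupport V) : ∃ C, ∀ x, ‖fderiv ℝ V x‖ ≤ C :=
  (hV.continuous_fderiv one_ne_zero).bounded_above_of_compact_support (hVc.fderiv (𝕜 := ℝ))

/-- Turns the integrand into one total derivative applied to the pair (weight, field), the form in
which the chain rule is applied. -/
theorem deriv_mul_add_fderiv_eq {F : Type*} [NormedAddCommGroup F] [NormedSpace ℝ F]
    {v V : ℝ × F → ℝ} (hV : ContDiff ℝ 1 V) {t : ℝ} {x : F} (h : V =ᶠ[𝓝 (t, x)] v) (a : ℝ)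
    (w : F) :
    deriv (fun t => v (t, x)) t * a + fderiv ℝ (fun x => v (t, x)) x w
      = fderiv ℝ V (t, x) (a, w) := by
  have hv : HasFDerivAt v (fderiv ℝ V (t, x)) (t, x) :=
    ((hV.differentiable one_ne_zero _).hasFDerivAt).congr_of_eventuallyEq h.symm
  have h1 : HasDerivAt (fun t => v (t, x)) (fderiv ℝ V (t, x) (1, 0)) t :=
    hv.comp_hasDerivAt t ((hasDerivAt_id t).prodMk (hasDerivAt_const t x))
  have h2 : HasFDerivAt (fun x => v (t, x))
      ((fderiv ℝ V (t, x)).comp (ContinuousLinearMap.inr ℝ ℝ F)) x :=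
    hv.comp x (hasFDerivAt_prodMk_right t x)
  rw [h1.deriv, h2.fderiv, ContinuousLinearMap.comp_apply, ContinuousLinearMap.inr_apply, mul_comm,
    ← smul_eq_mul, ← map_smul, ← map_add]
  simp

/-! ### The occupation measure as an image measure -/

section Occupation

variable {t₀ tf p : ℝ} {n m : ℕ} {Y : Set (Euc n)}
  {c : ℝ → Euc n → Euc m → Euc n} {d : ℝ → Euc m → Euc n} {f : ℝ → Euc n → Euc m → Euc n}
  {y₀ yf : Euc n} {σ : Measure ℝ} {ν : Kernel ℝ (Gam m)} {y : ℝ → Euc n} {ys : ℝ → ℝ → Euc n}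

/-- The segment from `y(t⁻)` to `y(t⁺)`, parametrized by `[0, 1]`. -/
noncomputable def jumpSegment {n : ℕ} (y : ℝ → Euc n) (t r : ℝ) : Euc n :=
  Function.leftLim y t + r • (Function.rightLim y t - Function.leftLim y t)

theorem measurable_jumpSegment {y : ℝ → Euc n} (hy : BoundedVariationOn y univ) :
    Measurable fun q : ℝ × ℝ => jumpSegment y q.1 q.2 := by
  have h1 := measurable_of_boundedVariationOn hy.leftLim
  have h2 := measurable_of_boundedVariationOn hy.rightLim
  unfold jumpSegment
  fun_prop

theorem measurable_graph_jumpSegment {y : ℝ → Euc n} (hy : BoundedVariationOn y univ) :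
    Measurable fun q : ℝ × ℝ × Gam m => (q.1, jumpSegment y q.1 q.2.1, q.2.2) :=
  measurable_fst.prodMk (((measurable_jumpSegment hy).comp
    (by fun_prop : Measurable fun q : ℝ × ℝ × Gam m => (q.1, q.2.1))).prodMk (by fun_prop))

/-- The law on `[0, 1] × γℝᵐ` of the position on the jump segment and of the control. -/
noncomputable def positionControl {m : ℕ} (ν : Kernel ℝ (Gam m)) : Kernel ℝ (ℝ × Gam m) :=
  Kernel.const ℝ (volume.restrict (Icc (0 : ℝ) 1)) ×ₖ ν

instance isProbabilityMeasure_volume_restrict_Icc :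
    IsProbabilityMeasure (volume.restrict (Icc (0 : ℝ) 1)) := ⟨by simp⟩

instance [IsMarkovKernel ν] : IsMarkovKernel (positionControl ν) := by
  unfold positionControl
  infer_instance

theorem positionControl_apply [IsMarkovKernel ν] (t : ℝ) :
    positionControl ν t = (volume.restrict (Icc (0 : ℝ) 1)).prod (ν t) := by
  rw [positionControl, Kernel.prod_apply, Kernel.const_apply]

/-- Rescaling fictitious time to `[0, 1]` accounts for the factor `1 / σ({s})` in `stateLaw`. -/
theorem map_volume_restrict_Icc_zero_one {ℓ : ℝ} (hℓ : 0 < ℓ) :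
    (volume.restrict (Icc (0 : ℝ) 1)).map (ℓ * ·)
      = (ENNReal.ofReal ℓ)⁻¹ • volume.restrict (Icc 0 ℓ) := by
  have h1 : (ℓ * ·) ⁻¹' Icc 0 ℓ = Icc (0 : ℝ) 1 := by
    rw [preimage_const_mul_Icc₀ _ _ hℓ, zero_div, div_self hℓ.ne']
  rw [← h1, ← Measure.restrict_map (measurable_const_mul ℓ) measurableSet_Icc,
    Real.map_volume_mul_left hℓ.ne', Measure.restrict_smul, abs_of_pos (inv_pos.mpr hℓ),
    ENNReal.ofReal_inv_of_pos hℓ]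

theorem stateLaw_eq_map_of_notMem_atoms {t : ℝ} (ht : t ∉ atoms σ) (hy : ContinuousAt y t) :
    stateLaw σ y ys t = (volume.restrict (Icc (0 : ℝ) 1)).map (jumpSegment y t) := by
  have h1 : jumpSegment y t = fun _ => y t := by
    funext r
    rw [jumpSegment, hy.continuousWithinAt.leftLim_eq, hy.continuousWithinAt.rightLim_eq, sub_self,
      smul_zero, add_zero]
  rw [stateLaw, if_neg ht, h1, Measure.map_const, measure_univ, one_smul]

namespace IsRelaxedArc

variable [IsFiniteMeasure σ] [IsMarkovKernel ν]

theorem stateLaw_eq_map_of_mem_atoms (harc : IsRelaxedArc t₀ tf p Y f y₀ yf σ ν y ys)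
    (hf : DynamicsAssumption t₀ tf p Y c d) (hp : 1 ≤ p)
    (hcd : ∀ t y u, f t y u = c t y u + d t u) {s : ℝ} (hs : s ∈ atoms σ) :
    stateLaw σ y ys s = (volume.restrict (Icc (0 : ℝ) 1)).map (jumpSegment y s) := by
  have hpos := measureReal_singleton_pos_of_mem_atoms hs
  let g : ℝ → Euc n := fun r => Function.leftLim y s + r • meanField p f ν y s
  have hg : Measurable g := by fun_prop
  have h1 : jumpSegment y s = g ∘ (σ.real {s} * ·) := by
    funext r
    rw [jumpSegment, harc.rightLim_sub_leftLim hf hp hcd hs, smul_smul, mul_comm]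
    rfl
  have h2 : (volume.restrict (Icc 0 (σ.real {s}))).map (ys s)
      = (volume.restrict (Icc 0 (σ.real {s}))).map g :=
    Measure.map_congr <| (ae_restrict_mem measurableSet_Icc).mono fun r hr =>
      harc.fictitious_state_eq hf hp hcd hs r hr
  rw [stateLaw, if_pos hs, h2, h1, ← Measure.map_map hg (measurable_const_mul _),
    map_volume_restrict_Icc_zero_one hpos, Measure.map_smul, ofReal_measureReal]

/-- Atoms and other times receive a single description, as the image of a composition-product with a
Markov kernel, to which Fubini applies. The fibres need to agree only for `σ`-almost every `t`. -/
theorem occupationMeasure_eq_map (harc : IsRelaxedArc t₀ tf p Y f y₀ yf σ ν y ys)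
    (hf : DynamicsAssumption t₀ tf p Y c d) (hp : 1 ≤ p)
    (hcd : ∀ t y u, f t y u = c t y u + d t u) :
    occupationMeasure σ ν y ys = (σ ⊗ₘ positionControl ν).map
      fun q : ℝ × ℝ × Gam m => (q.1, jumpSegment y q.1 q.2.1, q.2.2) := by
  have hΨ := measurable_graph_jumpSegment (m := m) harc.state.bv
  rw [Measure.compProd_eq_comp_prod, Measure.map_comp _ _ hΨ, occupationMeasure]
  refine Measure.bind_congr_right ?_
  filter_upwards [harc.ae_continuousAt] with t ht
  have hlaw : stateLaw σ y ys t = (volume.restrict (Icc (0 : ℝ) 1)).map (jumpSegment y t) := by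
    by_cases htJ : t ∈ atoms σ
    · exact harc.stateLaw_eq_map_of_mem_atoms hf hp hcd htJ
    · exact stateLaw_eq_map_of_notMem_atoms htJ (ht htJ)
  have hm : Measurable (jumpSegment y t) :=
    (measurable_jumpSegment harc.state.bv).comp measurable_prodMk_left
  have hprod := Measure.map_prod_map (volume.restrict (Icc (0 : ℝ) 1)) (ν t) hm measurable_id
  rw [Measure.map_id] at hprod
  rw [Kernel.map_apply _ hΨ, Kernel.prod_apply, Kernel.id_apply, positionControl_apply, hlaw, hprod,
    Measure.dirac_prod, Measure.dirac_prod, Measure.map_map hΨ measurable_prodMk_left,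
    Measure.map_map measurable_prodMk_left (hm.prodMap measurable_id)]
  rfl

end IsRelaxedArc

end Occupation

end DiPernaMajda

namespace DiPernaMajda

/-! ### Integration against the occupation measure -/

section Occupation

variable {t₀ tf p : ℝ} {n m : ℕ} {Y : Set (Euc n)}
  {c : ℝ → Euc n → Euc m → Euc n} {d : ℝ → Euc m → Euc n} {f : ℝ → Euc n → Euc m → Euc n}
  {y₀ yf : Euc n} {σ : Measure ℝ} {ν : Kernel ℝ (Gam m)} {y : ℝ → Euc n} {ys : ℝ → ℝ → Euc n}
  [IsFiniteMeasure σ] [IsMarkovKernel ν]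

namespace IsRelaxedArc

/-- Once the state in the field is replaced by `y(t)`, the field depends on `(t, u)` alone, and its
integrability is pulled back through this projection. -/
theorem measurePreserving_time_control (harc : IsRelaxedArc t₀ tf p Y f y₀ yf σ ν y ys)
    (hf : DynamicsAssumption t₀ tf p Y c d) (hp : 1 ≤ p)
    (hcd : ∀ t y u, f t y u = c t y u + d t u) :
    MeasurePreserving (fun q : ℝ × Euc n × Gam m => (q.1, q.2.2)) (occupationMeasure σ ν y ys)
      (σ ⊗ₘ ν) := by
  have hm : Measurable fun q : ℝ × Euc n × Gam m => (q.1, q.2.2) := by fun_prop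
  have hΨ := measurable_graph_jumpSegment (m := m) harc.state.bv
  refine ⟨hm, ?_⟩
  have h1 : (positionControl ν).map Prod.snd = ν := by
    rw [← Kernel.snd_eq, positionControl, Kernel.snd_prod]
  rw [harc.occupationMeasure_eq_map hf hp hcd, Measure.map_map hm hΨ]
  conv_rhs => rw [← h1, Measure.compProd_map measurable_snd]
  rfl

/-- Almost everywhere for the occupation measure, the state may be replaced by that of the arc in the
scaled field. -/
theorem ae_occupationMeasure (harc : IsRelaxedArc t₀ tf p Y f y₀ yf σ ν y ys)
    (hf : DynamicsAssumption t₀ tf p Y c d) (hp : 1 ≤ p) (hY : IsCompact Y)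
    (hcd : ∀ t y u, f t y u = c t y u + d t u) :
    ∀ᵐ q ∂(occupationMeasure σ ν y ys), q.1 ∈ Icc t₀ tf ∧ q.2.1 ∈ Y ∧
      scaledField p f q.1 q.2.1 q.2.2 = scaledField p f q.1 (y q.1) q.2.2 := by
  have hΨ := measurable_graph_jumpSegment (m := m) harc.state.bv
  -- The equality of scaled fields is not evidently a measurable condition; `A` is measurable and
  -- implies it.
  let A : Set (ℝ × Euc n × Gam m) := {q | q.1 ∈ Icc t₀ tf ∧ q.2.1 ∈ Y ∧
    (q.2.1 = y q.1 ∨ ‖(q.2.2 : Euc m)‖ = 1)}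
  have hA : MeasurableSet A := by
    have h1 : MeasurableSet {q : ℝ × Euc n × Gam m | q.1 ∈ Icc t₀ tf} :=
      measurable_fst measurableSet_Icc
    have h2 : MeasurableSet {q : ℝ × Euc n × Gam m | q.2.1 ∈ Y} :=
      (by fun_prop : Measurable fun q : ℝ × Euc n × Gam m => q.2.1) hY.measurableSet
    have h3 : MeasurableSet {q : ℝ × Euc n × Gam m | q.2.1 = y q.1} :=
      measurableSet_eq_fun (by fun_prop) (harc.measurable_state.comp measurable_fst)
    have h4 : MeasurableSet {q : ℝ × Euc n × Gam m | ‖(q.2.2 : Euc m)‖ = 1} :=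
      measurableSet_eq_fun (by fun_prop) measurable_const
    exact h1.inter (h2.inter (h3.union h4))
  have hae : ∀ᵐ q ∂(occupationMeasure σ ν y ys), q ∈ A := by
    rw [harc.occupationMeasure_eq_map hf hp hcd, ae_map_iff (p := (· ∈ A)) hΨ.aemeasurable hA,
      Measure.ae_compProd_iff (hΨ hA)]
    filter_upwards [harc.control.ae_mem, harc.ae_continuousAt] with t htT htc
    rw [positionControl_apply]
    by_cases htJ : t ∈ atoms σ
    · have h1 : ∀ᵐ q ∂((volume.restrict (Icc (0 : ℝ) 1)).prod (ν t)), q.1 ∈ Icc (0 : ℝ) 1 :=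
        Measure.quasiMeasurePreserving_fst.ae (ae_restrict_mem measurableSet_Icc)
      have h2 : ∀ᵐ q : ℝ × Gam m ∂((volume.restrict (Icc (0 : ℝ) 1)).prod (ν t)),
          ‖(q.2 : Euc m)‖ = 1 :=
        Measure.quasiMeasurePreserving_snd.ae (ae_norm_eq_one_of_weightMean_eq_zero hp
          (harc.control.weightMean_eq_zero_of_mem_atoms hp htJ))
      filter_upwards [h1, h2] with ⟨r, z⟩ hr hz
      refine ⟨htT, ?_, Or.inr hz⟩
      have hpos := measureReal_singleton_pos_of_mem_atoms htJ
      -- Position `r` on the unit segment is fictitious time `r σ({t})`, at which the fictitious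
      -- state lies in `Y` by assumption.
      have hmem : r * σ.real {t} ∈ Icc 0 (σ.real {t}) :=
        ⟨mul_nonneg hr.1 hpos.le, mul_le_of_le_one_left hpos.le hr.2⟩
      have h3 : jumpSegment y t r = ys t (r * σ.real {t}) := by
        rw [harc.fictitious_state_eq hf hp hcd htJ _ hmem, jumpSegment,
          harc.rightLim_sub_leftLim hf hp hcd htJ, smul_smul]
      exact h3 ▸ harc.solution.jump_mem t htJ _ hmem
    · refine ae_of_all _ fun q => ?_
      have h3 : jumpSegment y t q.1 = y t := by
        rw [jumpSegment, (htc htJ).continuousWithinAt.leftLim_eq,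
          (htc htJ).continuousWithinAt.rightLim_eq, sub_self, smul_zero, add_zero]
      exact ⟨htT, h3 ▸ harc.state.mem t htT, Or.inl h3⟩
  obtain ⟨D, -, hDc, -, hDd⟩ := hf.exists_extension hp
  filter_upwards [hae] with ⟨t, x, z⟩ ⟨htT, hxY, h⟩
  refine ⟨htT, hxY, ?_⟩
  rcases h with h | h
  · simp only at h ⊢
    rw [h]
  · exact (hf.scaledField_of_norm_eq_one hp hcd (hDc t) htT (hDd t htT) hxY h).trans
      (hf.scaledField_of_norm_eq_one hp hcd (hDc t) htT (hDd t htT)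
        (harc.state.mem t htT) h).symm

theorem integrable_weight_scaledField (harc : IsRelaxedArc t₀ tf p Y f y₀ yf σ ν y ys)
    (hf : DynamicsAssumption t₀ tf p Y c d) (ht : t₀ < tf) (hp : 1 ≤ p) (hY : IsCompact Y)
    (hcd : ∀ t y u, f t y u = c t y u + d t u) :
    Integrable (fun q : ℝ × Gam m => (weight p q.2, scaledField p f q.1 (y q.1) q.2))
      (σ ⊗ₘ ν) := by
  refine Integrable.prodMk ?_ (harc.integrable_scaledField hf ht hp hY hcd)
  refine Integrable.of_bound ((continuous_weight hp).measurable.comp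
    measurable_snd).aestronglyMeasurable 1 (ae_of_all _ fun q => ?_)
  rw [Real.norm_of_nonneg (weight_mem_Icc hp q.2).1]
  exact (weight_mem_Icc hp q.2).2

theorem integrable_fderiv (harc : IsRelaxedArc t₀ tf p Y f y₀ yf σ ν y ys)
    (hf : DynamicsAssumption t₀ tf p Y c d) (ht : t₀ < tf) (hp : 1 ≤ p) (hY : IsCompact Y)
    (hcd : ∀ t y u, f t y u = c t y u + d t u) {V : ℝ × Euc n → ℝ} (hV : ContDiff ℝ 1 V) {C : ℝ}
    (hC : ∀ x, ‖fderiv ℝ V x‖ ≤ C) :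
    Integrable (fun q : ℝ × Euc n × Gam m => fderiv ℝ V (q.1, q.2.1)
      (weight p q.2.2, scaledField p f q.1 (y q.1) q.2.2)) (occupationMeasure σ ν y ys) := by
  have h1 := (harc.measurePreserving_time_control hf hp hcd).integrable_comp_of_integrable
    (harc.integrable_weight_scaledField hf ht hp hY hcd)
  have h2 : Continuous fun q : ℝ × Euc n × Gam m => fderiv ℝ V (q.1, q.2.1) :=
    (hV.continuous_fderiv one_ne_zero).comp (by fun_prop)
  refine (h1.norm.const_mul C).mono' (isBoundedBilinearMap_apply.continuous.comp_aestronglyMeasurable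
    (h2.aestronglyMeasurable.prodMk h1.1)) (ae_of_all _ fun q => ?_)
  exact (ContinuousLinearMap.le_opNorm _ _).trans
    (mul_le_mul_of_nonneg_right (hC _) (norm_nonneg _))

/-- For fixed `t` the derivative depends only on the position `r` and the pair (weight, field) only
on the control. Integrating in `u` averages the pair, and integrating in `r` averages the derivative
over the jump segment. -/
theorem integral_fderiv (harc : IsRelaxedArc t₀ tf p Y f y₀ yf σ ν y ys)
    (hf : DynamicsAssumption t₀ tf p Y c d) (ht : t₀ < tf) (hp : 1 ≤ p) (hY : IsCompact Y)
    (hcd : ∀ t y u, f t y u = c t y u + d t u) {V : ℝ × Euc n → ℝ} (hV : ContDiff ℝ 1 V) {C : ℝ}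
    (hC : ∀ x, ‖fderiv ℝ V x‖ ≤ C) :
    ∫ q : ℝ × Euc n × Gam m, fderiv ℝ V (q.1, q.2.1)
        (weight p q.2.2, scaledField p f q.1 (y q.1) q.2.2) ∂(occupationMeasure σ ν y ys)
      = ∫ t, meanDeriv V (t, Function.leftLim y t) (t, Function.rightLim y t)
          (weightMean p ν t, meanField p f ν y t) ∂σ := by
  have hΨ := measurable_graph_jumpSegment (m := m) harc.state.bv
  have hint := harc.integrable_fderiv hf ht hp hY hcd hV hC
  rw [harc.occupationMeasure_eq_map hf hp hcd] at hint ⊢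
  rw [integral_map hΨ.aemeasurable hint.1]
  have hint2 := hint.comp_measurable hΨ
  have hsec := ((Measure.integrable_compProd_iff hint2.1).mp hint2).1
  have hws := ((Measure.integrable_compProd_iff
    (harc.integrable_weight_scaledField hf ht hp hY hcd).1).mp
    (harc.integrable_weight_scaledField hf ht hp hY hcd)).1
  refine (Measure.integral_compProd hint2).trans (integral_congr_ae ?_)
  filter_upwards [hsec, hws] with t h1 h2
  rw [positionControl_apply] at h1 ⊢
  rw [integral_prod _ h1, meanDeriv_apply hV, intervalIntegral.integral_of_le zero_le_one,
    ← integral_Icc_eq_integral_Ioc]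
  congr 1
  funext r
  have h3 : ((t, Function.leftLim y t) : ℝ × Euc n)
      + r • ((t, Function.rightLim y t) - (t, Function.leftLim y t)) = (t, jumpSegment y t r) := by
    simp [jumpSegment]
  have h4 : (weightMean p ν t, meanField p f ν y t)
      = ∫ z, (weight p z, scaledField p f t (y t) z) ∂(ν t) := by
    rw [integral_pair h2.fst h2.snd]
    rfl
  rw [h3, h4, ← ContinuousLinearMap.integral_comp_comm _ h2]
  rfl

/-- The graph of the right limits is a primitive with respect to `σ`. -/
theorem graph_eq (harc : IsRelaxedArc t₀ tf p Y f y₀ yf σ ν y ys)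
    (hf : DynamicsAssumption t₀ tf p Y c d) (ht : t₀ < tf) (hp : 1 ≤ p) (hY : IsCompact Y)
    (hcd : ∀ t y u, f t y u = c t y u + d t u) {τ : ℝ} (hτ : τ ∈ Icc t₀ tf) :
    ((τ, Function.leftLim y τ) : ℝ × Euc n) = (t₀, Function.leftLim y t₀)
        + ∫ t in Ioo (t₀ - 1) τ, (weightMean p ν t, meanField p f ν y t) ∂σ ∧
      ((τ, Function.rightLim y τ) : ℝ × Euc n) = (t₀, Function.leftLim y t₀)
        + ∫ t in Ioc (t₀ - 1) τ, (weightMean p ν t, meanField p f ν y t) ∂σ := by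
  have hw : Integrable (weightMean p ν) σ := integrable_weightMean hp
  have hF := harc.integrable_meanField hf ht hp hY hcd
  -- Time itself is the primitive of `weightMean`; since a point has Lebesgue measure zero, open and
  -- half-open intervals give the same value.
  have h1 : ∫ t in Ioo (t₀ - 1) τ, weightMean p ν t ∂σ = τ - t₀ := by
    have h2 : ∫ t in Ioo (t₀ - 1) τ, weightMean p ν t ∂σ
        = ∫ t in Ico t₀ τ, weightMean p ν t ∂σ := by
      refine setIntegral_congr_set ?_
      filter_upwards [harc.control.ae_mem] with t ht
      refine propext ⟨fun h => ⟨ht.1, h.2⟩, fun h => ⟨?_, h.2⟩⟩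
      linarith [ht.1]
    rw [h2, harc.control.setIntegral_weightMean hp measurableSet_Ico
      (Ico_subset_Icc_self.trans (Icc_subset_Icc_right hτ.2)), Real.volume_real_Ico_of_le hτ.1]
  have h3 : ∫ t in Ioc (t₀ - 1) τ, weightMean p ν t ∂σ = τ - t₀ := by
    rw [harc.setIntegral_Ioc_eq_Icc, harc.control.setIntegral_weightMean hp measurableSet_Icc
      (Icc_subset_Icc_right hτ.2), Real.volume_real_Icc_of_le hτ.1]
  rw [integral_pair hw.integrableOn hF.integrableOn, integral_pair hw.integrableOn hF.integrableOn,
    h1, h3, Prod.mk_add_mk, Prod.mk_add_mk, add_sub_cancel,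
    ← harc.leftLim_eq hf ht hp hY hcd hτ, ← harc.rightLim_eq hf ht hp hY hcd hτ]
  exact ⟨rfl, rfl⟩

theorem integral_meanDeriv (harc : IsRelaxedArc t₀ tf p Y f y₀ yf σ ν y ys)
    (hf : DynamicsAssumption t₀ tf p Y c d) (ht : t₀ < tf) (hp : 1 ≤ p) (hY : IsCompact Y)
    (hcd : ∀ t y u, f t y u = c t y u + d t u) {V : ℝ × Euc n → ℝ} (hV : ContDiff ℝ 1 V) {C : ℝ}
    (hC : ∀ x, ‖fderiv ℝ V x‖ ≤ C) :
    ∫ t, meanDeriv V (t, Function.leftLim y t) (t, Function.rightLim y t)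
        (weightMean p ν t, meanField p f ν y t) ∂σ
      = V (tf, Function.rightLim y tf) - V (t₀, Function.leftLim y t₀) := by
  have hΦ : Integrable (fun t => (weightMean p ν t, meanField p f ν y t)) σ :=
    (integrable_weightMean hp).prodMk (harc.integrable_meanField hf ht hp hY hcd)
  have h1 := sub_eq_setIntegral_meanDeriv hΦ hV hC (by linarith : t₀ - 1 < tf)
    (t₀, Function.leftLim y t₀)
  rw [← (harc.graph_eq hf ht hp hY hcd (right_mem_Icc.mpr ht.le)).2] at h1
  rw [h1]
  have h2 : σ.restrict (Ioc (t₀ - 1) tf) = σ := by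
    refine Measure.restrict_eq_self_of_ae_mem ?_
    filter_upwards [harc.control.ae_mem] with t ht
    exact ⟨by linarith [ht.1], ht.2⟩
  rw [h2]
  refine integral_congr_ae ?_
  filter_upwards [harc.control.ae_mem] with t htT
  obtain ⟨e1, e2⟩ := harc.graph_eq hf ht hp hY hcd htT
  rw [e1, e2]

end IsRelaxedArc

end Occupation

end DiPernaMajda

/-! ### The weak (Liouville) equation for the occupation measure -/

theorem mainTheorem4 (n m : ℕ) (t₀ tf p : ℝ) (ht : t₀ < tf) (hp : 1 ≤ p)
    (Y : Set (DiPernaMajda.Euc n)) (hY : IsCompact Y)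
    (c : ℝ → DiPernaMajda.Euc n → DiPernaMajda.Euc m → DiPernaMajda.Euc n)
    (d : ℝ → DiPernaMajda.Euc m → DiPernaMajda.Euc n)
    (hf : DiPernaMajda.DynamicsAssumption t₀ tf p Y c d)
    (f : ℝ → DiPernaMajda.Euc n → DiPernaMajda.Euc m → DiPernaMajda.Euc n)
    (hcd : ∀ t y u, f t y u = c t y u + d t u)
    (y₀ yf : DiPernaMajda.Euc n)
    (σ : Measure ℝ) [IsFiniteMeasure σ]
    (ν : Kernel ℝ (DiPernaMajda.Gam m)) [IsMarkovKernel ν]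
    (y : ℝ → DiPernaMajda.Euc n) (ys : ℝ → ℝ → DiPernaMajda.Euc n)
    (harc : DiPernaMajda.IsRelaxedArc t₀ tf p Y f y₀ yf σ ν y ys)
    (v : ℝ × DiPernaMajda.Euc n → ℝ) (U : Set (ℝ × DiPernaMajda.Euc n)) (hU : IsOpen U)
    (hTYU : Icc t₀ tf ×ˢ Y ⊆ U) (hv : ContDiffOn ℝ 1 v U) :
    Integrable
      (fun q : ℝ × DiPernaMajda.Euc n × DiPernaMajda.Gam m =>
        deriv (fun t => v (t, q.2.1)) q.1 * DiPernaMajda.weight p q.2.2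
          + fderiv ℝ (fun x => v (q.1, x)) q.2.1
              (DiPernaMajda.scaledField p f q.1 q.2.1 q.2.2))
      (DiPernaMajda.occupationMeasure σ ν y ys) ∧
    ∫ q : ℝ × DiPernaMajda.Euc n × DiPernaMajda.Gam m,
        (deriv (fun t => v (t, q.2.1)) q.1 * DiPernaMajda.weight p q.2.2
          + fderiv ℝ (fun x => v (q.1, x)) q.2.1
              (DiPernaMajda.scaledField p f q.1 q.2.1 q.2.2))
        ∂(DiPernaMajda.occupationMeasure σ ν y ys)
      = v (tf, Function.rightLim y tf) - v (t₀, Function.leftLim y t₀) := by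
  obtain ⟨V, hV, hVc, hVv⟩ := DiPernaMajda.exists_contDiff_hasCompactSupport_eventuallyEq
    (isCompact_Icc.prod hY) hU hTYU hv
  obtain ⟨C, hC⟩ := DiPernaMajda.exists_norm_fderiv_le hV hVc
  -- Two replacements hold almost everywhere: `v` by its compactly supported localization, whose
  -- derivative is bounded, and the state in the field by that of the arc. The state at which the
  -- derivative is evaluated must stay.
  have hae : (fun q : ℝ × DiPernaMajda.Euc n × DiPernaMajda.Gam m =>
      deriv (fun t => v (t, q.2.1)) q.1 * DiPernaMajda.weight p q.2.2
        + fderiv ℝ (fun x => v (q.1, x)) q.2.1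
            (DiPernaMajda.scaledField p f q.1 q.2.1 q.2.2))
      =ᵐ[DiPernaMajda.occupationMeasure σ ν y ys] fun q => fderiv ℝ V (q.1, q.2.1)
        (DiPernaMajda.weight p q.2.2, DiPernaMajda.scaledField p f q.1 (y q.1) q.2.2) := by
    filter_upwards [harc.ae_occupationMeasure hf hp hY hcd] with q ⟨h1, h2, h3⟩
    rw [h3]
    exact DiPernaMajda.deriv_mul_add_fderiv_eq hV (hVv _ ⟨h1, h2⟩) _ _
  have htf : tf ∈ Icc t₀ tf := right_mem_Icc.mpr ht.le
  have ht₀ : t₀ ∈ Icc t₀ tf := left_mem_Icc.mpr ht.le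
  refine ⟨(harc.integrable_fderiv hf ht hp hY hcd hV hC).congr hae.symm, ?_⟩
  rw [integral_congr_ae hae, harc.integral_fderiv hf ht hp hY hcd hV hC,
    harc.integral_meanDeriv hf ht hp hY hcd hV hC,
    (hVv _ ⟨htf, (harc.leftLim_rightLim_mem hf ht hp hY hcd htf).2⟩).eq_of_nhds,
    (hVv _ ⟨ht₀, (harc.leftLim_rightLim_mem hf ht hp hY hcd ht₀).1⟩).eq_of_nhds]
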